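/- **Model.** For strings $x,y$ let $\mathrm{ed}(x,y)$ be the smallest number of character insertions, deletions and substitutions that transform $x$ into $y$. In the asymmetric streaming model the input consists of an offline string $\bar s$, to whose characters (and length) the algorithm has read-only random access, and an online string $s$, which arrives as a stream and is read once, one character after the other. An algorithm is a fixed deterministic program on a random access memory of natural numbers. Its memory is the number of bits in use: every nonzero cell is charged the binary length of its address plus that of its contents, and the maximum over the whole run, internal computations included, is counted. Characters are natural numbers below $\sigma$, so that one character takes $O(\log(\sigma+2))$ bits. **Theorem.** There is a deterministic single-pass asymmetric streaming algorithm that approximates the edit distance within a factor $1+\varepsilon$ in memory $\tilde O(\sqrt n/\varepsilon)$ for every $\varepsilon>0$ (for $\varepsilon > 1$, in memory $\tilde O(\sqrt n)$). Precisely, there are one program $P$ and absolute constants $C$ and $k$ such that for every real $\varepsilon>0$, every $n\ge 1$, every $\sigma$, and all strings $\bar s,s$ of length $n$ over the alphabet $\{0,\dots,\sigma-1\}$, the program $P$, given the accuracy parameter $\lceil 1/\varepsilon\rceil$, random access to $\bar s$ and a single pass over $s$, halts with a number $v$ satisfying $$\mathrm{ed}(\bar s,s)\ \le\ v\ \le\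 (1+\varepsilon)\,\mathrm{ed}(\bar s,s),$$ and uses at most $$C\cdot\frac{\sqrt n}{\min\{\varepsilon,1\}}\cdot(\log(n+2))^k\cdot\log(\sigma+2)$$ bits of memory. -/

import Mathlib

/-! ### Edit distance -/

/-- One character insertion, deletion or substitution. -/
inductive EditStep {α : Type*} : List α → List α → Prop
  | insertion (u v : List α) (a : α) : EditStep (u ++ v) (u ++ a :: v)
  | deletion (u v : List α) (a : α) : EditStep (u ++ a :: v) (u ++ v)
  | substitution (u v : List α) (a b : α) : EditStep (u ++ a :: v) (u ++ b :: v)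

/-- `Edits k x y`: some sequence of exactly `k` edit operations transforms `x` into `y`. -/
inductive Edits {α : Type*} : ℕ → List α → List α → Prop
  | refl (x : List α) : Edits 0 x x
  | step {k : ℕ} {x y z : List α} : Edits k x y → EditStep y z → Edits (k + 1) x z

/-- The edit distance: the smallest number of insertions, deletions and substitutions
that transform `x` into `y`. -/
noncomputable def editDist {α : Type*} (x y : List α) : ℕ :=
  sInf {k : ℕ | Edits k x y}

/-- Any string can be transformed into any other, so the minimum in `editDist` is over a
nonempty set. -/
theorem exists_edits {α : Type*} (x y : List α) : ∃ k, Edits k x y := by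
  have h1 : ∃ k, Edits k x [] := by
    suffices h : ∀ w : List α, (∃ k, Edits k x w) → ∃ k, Edits k x [] from h x ⟨0, .refl x⟩
    intro w
    induction w with
    | nil => exact id
    | cons a w ih =>
      rintro ⟨k, hk⟩
      exact ih ⟨k + 1, hk.step (EditStep.deletion [] w a)⟩
  induction y with
  | nil => exact h1
  | cons a y ih =>
    obtain ⟨k, hk⟩ := ih
    exact ⟨k + 1, hk.step (EditStep.insertion [] y a)⟩

/-- The minimum in `editDist` is attained. -/
theorem edits_editDist {α : Type*} (x y : List α) : Edits (editDist x y) x y :=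
  Nat.sInf_mem (exists_edits x y)

/-! ### Asymmetric streaming algorithms

A small imperative language over a random access memory, with read-only random access to an
offline string and one-way, single-pass access to an online string.  Characters are natural
numbers.  A program is a fixed finite text, which depends neither on the lengths of the strings
nor on the accuracy parameter. -/

namespace AsymStream

/-- The read-only part of the input: the offline string and an accuracy parameter. -/
structure Input where
  offline : List ℕ
  param : ℕ

/-- The working memory: cells addressed by natural numbers, holding natural numbers, all but
finitely many of them `0`. -/
abbrev Memory := ℕ →₀ ℕ

/-- The number of bits in use: every nonzero cell is charged the binary length of its address
plus the binary length of its contents. -/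
def Memory.bits (m : Memory) : ℕ :=
  m.sum fun address value => Nat.size address + Nat.size value

/-- Expressions, with values in the natural numbers. -/
inductive Expr
  /-- A numeral. -/
  | const (c : ℕ)
  /-- The length `n` of the offline string. -/
  | len
  /-- The accuracy parameter. -/
  | param
  /-- The contents of the memory cell with the given address. -/
  | load (address : Expr)
  /-- The character of the offline string at the given (0-based) position. -/
  | query (position : Expr)
  | add (e f : Expr)
  /-- Truncated subtraction. -/
  | sub (e f : Expr)
  | mul (e f : Expr)
  /-- Quotient rounded down (`0` on division by zero). -/
  | div (e f : Expr)
  | mod (e f : Expr)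
  /-- `1` if `e < f`, and `0` otherwise. -/
  | lt (e f : Expr)
  /-- `1` if `e = f`, and `0` otherwise. -/
  | eq (e f : Expr)

/-- The value of an expression.  A query outside the offline string is answered by `0`. -/
def Expr.eval (inp : Input) (m : Memory) : Expr → ℕ
  | .const c => c
  | .len => inp.offline.length
  | .param => inp.param
  | .load a => m (a.eval inp m)
  | .query p => inp.offline.getD (p.eval inp m) 0
  | .add e f => e.eval inp m + f.eval inp m
  | .sub e f => e.eval inp m - f.eval inp m
  | .mul e f => e.eval inp m * f.eval inp m
  | .div e f => e.eval inp m / f.eval inp m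
  | .mod e f => e.eval inp m % f.eval inp m
  | .lt e f => if e.eval inp m < f.eval inp m then 1 else 0
  | .eq e f => if e.eval inp m = f.eval inp m then 1 else 0

/-- Programs. -/
inductive Program
  | skip
  /-- Write the value of an expression to the cell with the given address. -/
  | store (address value : Expr)
  /-- Move the next character of the stream to the cell with the given address. -/
  | read (address : Expr)
  | seq (p q : Program)
  /-- Run `p` if the condition is nonzero, and `q` if it is zero. -/
  | ite (cond : Expr) (p q : Program)
  /-- Repeat `p` as long as the condition is nonzero. -/
  | loop (cond : Expr) (p : Program)

/-- A configuration: the working memory and the part of the stream that is still unread. -/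
structure Config where
  mem : Memory
  stream : List ℕ

/-- `Runs inp B p c c'`: started in configuration `c`, the program `p` halts in configuration
`c'`, and at no moment does the working memory hold more than `B` bits.
A character that has been read is gone from the stream; reading from an exhausted stream
gives `0`. -/
inductive Runs (inp : Input) (B : ℕ) : Program → Config → Config → Prop
  | skip (c : Config) (hc : Memory.bits c.mem ≤ B) : Runs inp B .skip c c
  | store (a e : Expr) (c : Config) (hc : Memory.bits c.mem ≤ B)
      (hB : Memory.bits (c.mem.update (a.eval inp c.mem) (e.eval inp c.mem)) ≤ B) :
      Runs inp B (.store a e) c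
        ⟨c.mem.update (a.eval inp c.mem) (e.eval inp c.mem), c.stream⟩
  | read (a : Expr) (c : Config) (hc : Memory.bits c.mem ≤ B)
      (hB : Memory.bits (c.mem.update (a.eval inp c.mem) (c.stream.headD 0)) ≤ B) :
      Runs inp B (.read a) c
        ⟨c.mem.update (a.eval inp c.mem) (c.stream.headD 0), c.stream.tail⟩
  | seq {p q : Program} {c c' c'' : Config} :
      Runs inp B p c c' → Runs inp B q c' c'' → Runs inp B (.seq p q) c c''
  | ite_true {e : Expr} {p q : Program} {c c' : Config} :
      e.eval inp c.mem ≠ 0 → Runs inp B p c c' → Runs inp B (.ite e p q) c c'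
  | ite_false {e : Expr} {p q : Program} {c c' : Config} :
      e.eval inp c.mem = 0 → Runs inp B q c c' → Runs inp B (.ite e p q) c c'
  | loop_step {e : Expr} {p : Program} {c c' c'' : Config} :
      e.eval inp c.mem ≠ 0 → Runs inp B p c c' → Runs inp B (.loop e p) c' c'' →
      Runs inp B (.loop e p) c c''
  | loop_done {e : Expr} {p : Program} (c : Config) (hc : Memory.bits c.mem ≤ B) :
      e.eval inp c.mem = 0 → Runs inp B (.loop e p) c c

/-- Programs are deterministic: the final configuration is determined by the initial one. -/
theorem Runs.unique {inp : Input} {B B' : ℕ} {p : Program} {c c₁ c₂ : Config}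
    (h₁ : Runs inp B p c c₁) (h₂ : Runs inp B' p c c₂) : c₁ = c₂ := by
  induction h₁ generalizing c₂ with
  | skip c hc => cases h₂; rfl
  | store a e c hc hB => cases h₂; rfl
  | read a c hc hB => cases h₂; rfl
  | seq _ _ ih₁ ih₂ =>
    cases h₂ with
    | seq h h' => rw [← ih₁ h] at h'; exact ih₂ h'
  | ite_true he _ ih =>
    cases h₂ with
    | ite_true _ h => exact ih h
    | ite_false he' _ => exact absurd he' he
  | ite_false he _ ih =>
    cases h₂ with
    | ite_true he' _ => exact absurd he he'
    | ite_false _ h => exact ih h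
  | loop_step he _ _ ih₁ ih₂ =>
    cases h₂ with
    | loop_step _ h h' => rw [← ih₁ h] at h'; exact ih₂ h'
    | loop_done _ _ he' => exact absurd he' he
  | loop_done c hc he =>
    cases h₂ with
    | loop_step he' _ _ => exact absurd he he'
    | loop_done _ _ _ => rfl

/-- `p.Outputs param offline online B v`: with accuracy parameter `param`, random access to
`offline` and a single pass over `online`, and starting from empty memory, the program halts
with the value `v` in cell `0`, and it never uses more than `B` bits of memory. -/
def Program.Outputs (p : Program) (param : ℕ) (offline online : List ℕ) (B v : ℕ) : Prop :=
  ∃ c : Config, Runs ⟨offline, param⟩ B p ⟨0, online⟩ c ∧ c.mem 0 = v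

end AsymStream

/-! ### The dynamic program for the edit distance -/

/-! Consider the dynamic programming table whose rows `t` are prefixes of the stream and whose
columns `p` are prefixes of the offline string. The stream is cut into blocks of `b = ⌈√n⌉`
characters. Given the row above a block, the block is swept column by column, which needs only its
characters and one column of at most `b + 1` entries. The recurrence carries one-sided
approximations with a factor `F ≥ 1` along without loss (`Approx.succ_succ`).

What passes from one block to the next is a row, and it is thinned out. An entry of row `t` is at
least its distance `|p - t|` from the diagonal (`sub_le_prefixDist`), and neighbouring entries
differ by at most one. So a gap of at most `|p - t| / R` to the last kept position on the left costs
only a factor `1 + 2 / R` (`rowApprox_of_kept`). Kept positions are spaced in proportion to `|p -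
t|`, which leaves `O(R)` of them in each dyadic range of `|p - t|` and `O(R log n)` in all
(`card_keptSet_le`).

There are at most `b` blocks. With `q = ⌈1/ε⌉` and `R = 4 * q * b` the accumulated factor is at most
`(1 + 2 / R) ^ b ≤ 1 + 1 / q ≤ 1 + ε` (`one_add_pow_le`), while `O(R log n)` cells of logarithmic
size meet the space bound.

In memory, cells `0` to `8` are registers; the block, the column and the row occupy the residue
classes `9 + 3i`, `10 + 3i` and `11 + 3j`. Row entries are stored increased by one, so that `0`
means "not kept" and costs no bits. Old and new row share one array. -/

theorem Edits.trans {α : Type*} {j k : ℕ} {x y z : List α} (h₁ : Edits j x y)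
    (h₂ : Edits k y z) : Edits (j + k) x z := by
  induction h₂ with
  | refl => exact h₁
  | step _ hs ih => exact (ih h₁).step hs

theorem EditStep.cons {α : Type*} {x y : List α} (a : α) (h : EditStep x y) :
    EditStep (a :: x) (a :: y) := by
  cases h with
  | insertion u v b => exact EditStep.insertion (a :: u) v b
  | deletion u v b => exact EditStep.deletion (a :: u) v b
  | substitution u v b c => exact EditStep.substitution (a :: u) v b c

theorem Edits.cons {α : Type*} {k : ℕ} {x y : List α} (a : α) (h : Edits k x y) :
    Edits k (a :: x) (a :: y) := by
  induction h with
  | refl => exact .refl _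
  | step _ hs ih => exact ih.step (hs.cons a)

theorem EditStep.reverse {α : Type*} {x y : List α} (h : EditStep x y) :
    EditStep x.reverse y.reverse := by
  cases h with
  | insertion u v b => simpa using EditStep.insertion v.reverse u.reverse b
  | deletion u v b => simpa using EditStep.deletion v.reverse u.reverse b
  | substitution u v b c => simpa using EditStep.substitution v.reverse u.reverse b c

theorem Edits.reverse {α : Type*} {k : ℕ} {x y : List α} (h : Edits k x y) :
    Edits k x.reverse y.reverse := by
  induction h with
  | refl => exact .refl _
  | step _ hs ih => exact ih.step hs.reverse

/-- The recursive form of the edit distance. -/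
def lev : List ℕ → List ℕ → ℕ
  | [], y => y.length
  | x, [] => x.length
  | a :: x, b :: y =>
    min (min (lev x (b :: y) + 1) (lev (a :: x) y + 1)) (lev x y + if a = b then 0 else 1)
termination_by x y => x.length + y.length

theorem lev_nil_left (y : List ℕ) : lev [] y = y.length := by
  rw [lev]

theorem lev_nil_right (x : List ℕ) : lev x [] = x.length := by
  cases x <;> simp [lev]

theorem lev_cons_cons (a b : ℕ) (x y : List ℕ) : lev (a :: x) (b :: y) =
    min (min (lev x (b :: y) + 1) (lev (a :: x) y + 1)) (lev x y + if a = b then 0 else 1) := by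
  rw [lev]

theorem lev_cons_left_le (a : ℕ) (x y : List ℕ) : lev (a :: x) y ≤ lev x y + 1 := by
  cases y with
  | nil => simp [lev_nil_right]
  | cons b y => rw [lev_cons_cons]; omega

theorem lev_cons_right_le (b : ℕ) (x y : List ℕ) : lev x (b :: y) ≤ lev x y + 1 := by
  cases x with
  | nil => simp [lev_nil_left]
  | cons a x => rw [lev_cons_cons]; omega

theorem lev_le_cons_right (b : ℕ) (x y : List ℕ) : lev x y ≤ lev x (b :: y) + 1 := by
  induction x generalizing y b with
  | nil => simp only [lev_nil_left, List.length_cons]; omega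
  | cons a x ih =>
    rw [lev_cons_cons]
    have h1 := ih b y
    have h2 := lev_cons_left_le a x y
    split_ifs <;> omega

theorem lev_le_cons_left (a : ℕ) (x y : List ℕ) : lev x y ≤ lev (a :: x) y + 1 := by
  induction y generalizing x a with
  | nil => simp only [lev_nil_right, List.length_cons]; omega
  | cons b y ih =>
    rw [lev_cons_cons]
    have h1 := ih a x
    have h2 := lev_cons_right_le b x y
    split_ifs <;> omega

theorem lev_self (x : List ℕ) : lev x x = 0 := by
  induction x with
  | nil => simp [lev_nil_left]
  | cons a x ih => rw [lev_cons_cons]; simp [ih]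

/-- Reduces an edit in the middle of a string to an edit at its front. The hypothesis is needed for
all `x`, because the recursion strips characters from `x` as well. -/
theorem lev_append_left_le (u v w : List ℕ) (h : ∀ x, lev x v ≤ lev x w + 1) (x : List ℕ) :
    lev x (u ++ v) ≤ lev x (u ++ w) + 1 := by
  induction u generalizing x with
  | nil => exact h x
  | cons a u ih =>
    induction x with
    | nil =>
      have := ih []
      simp only [List.cons_append, lev_nil_left, List.length_cons] at this ⊢
      omega
    | cons b x ihx =>
      have h1 := ih x
      have h2 := ih (b :: x)
      simp only [List.cons_append] at ihx ⊢
      rw [lev_cons_cons, lev_cons_cons]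
      omega

theorem lev_subst_le (a b : ℕ) (v x : List ℕ) : lev x (b :: v) ≤ lev x (a :: v) + 1 := by
  induction x with
  | nil => simp [lev_nil_left]
  | cons c x ih =>
    rw [lev_cons_cons, lev_cons_cons]
    split_ifs <;> omega

/-- Since `lev x x = 0` and one edit raises `lev x` by at most one, `lev` bounds the number of edits
from below; edit sequences never have to be reordered or aligned. -/
theorem lev_step_le {y z : List ℕ} (h : EditStep y z) (x : List ℕ) :
    lev x z ≤ lev x y + 1 := by
  cases h with
  | insertion u v a => exact lev_append_left_le u _ _ (lev_cons_right_le a · v) x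
  | deletion u v a => exact lev_append_left_le u _ _ (lev_le_cons_right a · v) x
  | substitution u v a b => exact lev_append_left_le u _ _ (lev_subst_le a b v) x

theorem lev_le_of_edits {k : ℕ} {x y : List ℕ} (h : Edits k x y) : lev x y ≤ k := by
  induction h with
  | refl x => simp [lev_self]
  | step _ hs ih =>
    have := lev_step_le hs
    exact (this _).trans (by omega)

theorem edits_nil_left (y : List ℕ) : Edits y.length [] y := by
  induction y with
  | nil => exact .refl _
  | cons a y ih => exact ih.step (EditStep.insertion [] y a)

theorem edits_nil_right (x : List ℕ) : Edits x.length x [] := by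
  induction x with
  | nil => exact .refl _
  | cons a x ih => exact (ih.cons a).step (EditStep.deletion [] [] a)

theorem edits_lev (x y : List ℕ) : Edits (lev x y) x y := by
  induction x generalizing y with
  | nil => rw [lev_nil_left]; exact edits_nil_left y
  | cons a x ihx =>
    induction y with
    | nil => rw [lev_nil_right]; exact edits_nil_right _
    | cons b y ihy =>
      rw [lev_cons_cons]
      rcases min_choice (min (lev x (b :: y) + 1) (lev (a :: x) y + 1))
        (lev x y + if a = b then 0 else 1) with h | h <;> rw [h]
      · rcases min_choice (lev x (b :: y) + 1) (lev (a :: x) y + 1) with h | h <;> rw [h]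
        · rw [add_comm]
          exact ((Edits.refl _).step (EditStep.deletion [] x a)).trans (ihx (b :: y))
        · exact ihy.step (EditStep.insertion [] y b)
      · split_ifs with hab
        · subst hab; exact (ihx y).cons a
        · exact ((ihx y).cons a).step (EditStep.substitution [] y a b)

theorem editDist_eq_lev (x y : List ℕ) : editDist x y = lev x y :=
  le_antisymm (Nat.sInf_le (edits_lev x y)) (lev_le_of_edits (edits_editDist x y))

/-- Edit sequences can be mirrored. This is needed because `lev` recurses at the front of the
strings, whereas prefixes grow at the end. -/
theorem lev_reverse (x y : List ℕ) : lev x.reverse y.reverse = lev x y := by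
  apply le_antisymm
  · exact lev_le_of_edits (edits_lev x y).reverse
  · simpa using lev_le_of_edits (edits_lev x.reverse y.reverse).reverse

/-- The edit distance between the prefix of length `p` of `x` and the prefix of length `t`
of `y`. -/
def prefixDist (x y : List ℕ) (t p : ℕ) : ℕ :=
  lev (x.take p).reverse (y.take t).reverse

theorem prefixDist_length (x y : List ℕ) :
    prefixDist x y y.length x.length = editDist x y := by
  rw [prefixDist, List.take_length, List.take_length, lev_reverse, editDist_eq_lev]

theorem reverse_take_succ (x : List ℕ) {p : ℕ} (hp : p < x.length) :
    (x.take (p + 1)).reverse = x.getD p 0 :: (x.take p).reverse := by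
  rw [List.take_add_one]
  simp [List.getElem?_eq_getElem hp]

section

variable (x y : List ℕ) {t p : ℕ}

theorem prefixDist_zero_left (hp : p ≤ x.length) : prefixDist x y 0 p = p := by
  simp [prefixDist, lev_nil_right, hp]

theorem prefixDist_zero_right (ht : t ≤ y.length) : prefixDist x y t 0 = t := by
  simp [prefixDist, lev_nil_left, ht]

theorem prefixDist_succ_succ (ht : t < y.length) (hp : p < x.length) :
    prefixDist x y (t + 1) (p + 1) =
      min (min (prefixDist x y (t + 1) p + 1) (prefixDist x y t (p + 1) + 1))
        (prefixDist x y t p + if x.getD p 0 = y.getD t 0 then 0 else 1) := by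
  rw [prefixDist, prefixDist, prefixDist, prefixDist, reverse_take_succ x hp,
    reverse_take_succ y ht, lev_cons_cons]

theorem prefixDist_succ_right_le (hp : p < x.length) :
    prefixDist x y t (p + 1) ≤ prefixDist x y t p + 1 := by
  rw [prefixDist, reverse_take_succ x hp]
  exact lev_cons_left_le _ _ _

theorem prefixDist_le_succ_right (hp : p < x.length) :
    prefixDist x y t p ≤ prefixDist x y t (p + 1) + 1 := by
  rw [prefixDist, prefixDist, reverse_take_succ x hp]
  exact lev_le_cons_left _ _ _

theorem prefixDist_le_add {l : ℕ} (hl : l ≤ p) (hp : p ≤ x.length) :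
    prefixDist x y t l ≤ prefixDist x y t p + (p - l) := by
  induction p, hl using Nat.le_induction with
  | base => simp
  | succ p hl ih =>
    have := prefixDist_le_succ_right x y (t := t) (p := p) (by omega)
    have := ih (by omega)
    omega

theorem prefixDist_le_add_right {l : ℕ} (hl : l ≤ p) (hp : p ≤ x.length) :
    prefixDist x y t p ≤ prefixDist x y t l + (p - l) := by
  induction p, hl using Nat.le_induction with
  | base => simp
  | succ p hl ih =>
    have := prefixDist_succ_right_le x y (t := t) (p := p) (by omega)
    have := ih (by omega)
    omega

theorem prefixDist_le (ht : t ≤ y.length) (hp : p ≤ x.length) :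
    prefixDist x y t p ≤ t + p := by
  have := prefixDist_le_add_right x y (t := t) (Nat.zero_le p) hp
  rw [prefixDist_zero_right x y ht] at this
  omega

end

theorem length_le_lev (x y : List ℕ) :
    x.length ≤ lev x y + y.length ∧ y.length ≤ lev x y + x.length := by
  induction x generalizing y with
  | nil => simp [lev_nil_left]
  | cons a x ihx =>
    induction y with
    | nil => simp [lev_nil_right]
    | cons b y ihy =>
      have h1 := ihx (b :: y)
      have h2 := ihx y
      rw [lev_cons_cons]
      simp only [List.length_cons] at *
      split_ifs <;> omega

/-- One of the two truncated differences vanishes, so the left side is `|p - t|`, the difference in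
length, which each edit changes by at most one. It turns an additive error proportional to `|p - t|`
into a relative one. -/
theorem sub_le_prefixDist (x y : List ℕ) {t p : ℕ} (ht : t ≤ y.length) (hp : p ≤ x.length) :
    (p - t) + (t - p) ≤ prefixDist x y t p := by
  have := length_le_lev (x.take p).reverse (y.take t).reverse
  simp only [List.length_reverse, List.length_take, min_eq_left hp, min_eq_left ht] at this
  rw [prefixDist]
  omega

/-! ### Sparse rows -/

/-- The last kept position up to `p`, when the positions of row `t` are scanned from left to right
and a position is kept if its distance from the previous kept one is at least `1 / R` times its
distance from the diagonal. -/
def lastKept (R t : ℕ) : ℕ → ℕ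
  | 0 => 0
  | p + 1 =>
    if (p + 1 - t) + (t - (p + 1)) ≤ R * (p + 1 - lastKept R t p) then p + 1 else lastKept R t p

theorem lastKept_le (R t p : ℕ) : lastKept R t p ≤ p := by
  induction p with
  | zero => exact le_rfl
  | succ p ih => rw [lastKept]; split_ifs <;> omega

theorem lastKept_lastKept (R t p : ℕ) : lastKept R t (lastKept R t p) = lastKept R t p := by
  induction p with
  | zero => rfl
  | succ p ih =>
    by_cases h : (p + 1 - t) + (t - (p + 1)) ≤ R * (p + 1 - lastKept R t p)
    · have h' : lastKept R t (p + 1) = p + 1 := by rw [lastKept, if_pos h]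
      rw [h', h']
    · have h' : lastKept R t (p + 1) = lastKept R t p := by rw [lastKept, if_neg h]
      rw [h', ih]

theorem le_lastKept {R t l p : ℕ} (hl : lastKept R t l = l) (hlp : l ≤ p) :
    l ≤ lastKept R t p := by
  induction p, hlp using Nat.le_induction with
  | base => exact hl.ge
  | succ p hlp ih => rw [lastKept]; split_ifs <;> omega

/-- A skipped position failed the test for being kept. This half of the rule gives the accuracy. -/
theorem mul_sub_lastKept_le (R t p : ℕ) :
    R * (p - lastKept R t p) ≤ (p - t) + (t - p) := by
  cases p with
  | zero => simp
  | succ p =>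
    rw [lastKept]
    split_ifs with h
    · simp
    · exact (not_le.1 h).le

/-- The other half of the rule, which gives the count. The kept position just before `p` is at or to
the right of `l`, so `l` need not be that position. -/
theorem le_mul_sub_of_kept {R t l p : ℕ} (hl : lastKept R t l = l) (hp : lastKept R t p = p)
    (hlp : l < p) : (p - t) + (t - p) ≤ R * (p - l) := by
  cases p with
  | zero => omega
  | succ p =>
    rw [lastKept] at hp
    split_ifs at hp with h
    · refine h.trans (Nat.mul_le_mul_left _ ?_)
      have := le_lastKept hl (Nat.lt_succ_iff.1 hlp)
      omega
    · have := lastKept_le R t p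
      omega

/-- The kept positions of row `t`. -/
def keptSet (R t n : ℕ) : Finset ℕ :=
  (Finset.range (n + 1)).filter fun p => lastKept R t p = p

theorem mem_keptSet {R t n p : ℕ} : p ∈ keptSet R t n ↔ p ≤ n ∧ lastKept R t p = p := by
  simp [keptSet]

/-- On either side of the diagonal, kept positions with `|p - t|` between `2 ^ k` and `2 ^ (k + 1)`
are at least `2 ^ k / R` apart. The final `1` is for the position `t` itself. -/
theorem card_keptSet_le {R t n : ℕ} (hR : 0 < R) (ht : t ≤ n) :
    (keptSet R t n).card ≤ 4 * R * (Nat.log 2 n + 1) + 1 := by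
  let x : ℕ → ℕ := fun p => (p - t) + (t - p)
  -- The code of a position: its side, its dyadic scale, and its cell when that scale is cut into
  -- pieces of length `2 ^ k / R`. The last component is below `2 * R` because `x p < 2 ^ (k + 1)`.
  let f : ℕ → Bool × ℕ × ℕ := fun p => (decide (p < t), Nat.log 2 (x p),
    x p * R / 2 ^ Nat.log 2 (x p))
  let T : Finset (Bool × ℕ × ℕ) :=
    Finset.univ ×ˢ Finset.range (Nat.log 2 n + 1) ×ˢ Finset.range (2 * R)
  have hT : T.card = 4 * R * (Nat.log 2 n + 1) := by
    simp only [T, Finset.card_product, Finset.card_range, Finset.card_univ, Fintype.card_bool]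
    ring
  have hmaps : Set.MapsTo f ((keptSet R t n).erase t) T := by
    intro p hp
    obtain ⟨hpt, hp⟩ := Finset.mem_erase.1 hp
    obtain ⟨hpn, hp⟩ := mem_keptSet.1 hp
    have hx : x p ≤ n := by simp only [x]; omega
    simp only [f, T, Finset.coe_product, Set.mem_prod, Finset.coe_univ, Set.mem_univ,
      Finset.coe_range, Set.mem_Iio, true_and]
    refine ⟨Nat.lt_succ_iff.2 (Nat.log_mono_right hx), ?_⟩
    rw [Nat.div_lt_iff_lt_mul (by positivity)]
    have := Nat.lt_pow_succ_log_self (b := 2) (by norm_num) (x p)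
    rw [pow_succ] at this
    nlinarith
  have hlt : ∀ p q, p ∈ (keptSet R t n).erase t → q ∈ (keptSet R t n).erase t → p < q →
      f p ≠ f q := by
    intro p q hp hq hpq heq
    obtain ⟨hpt, hp⟩ := Finset.mem_erase.1 hp
    obtain ⟨hpn, hp⟩ := mem_keptSet.1 hp
    obtain ⟨hqt, hq⟩ := Finset.mem_erase.1 hq
    obtain ⟨hqn, hq⟩ := mem_keptSet.1 hq
    have hgap := le_mul_sub_of_kept hp hq hpq
    simp only [f, Prod.mk.injEq, decide_eq_decide] at heq
    obtain ⟨h1, h2, h3⟩ := heq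
    -- This fails for `x q = 0`, which is why `t` has been removed. Together with `hgap` it shows
    -- that `R * x` changes by at least a full cell width `w` between `p` and `q`, so the quotients
    -- differ.
    have hpow : 2 ^ Nat.log 2 (x q) ≤ x q :=
      Nat.pow_log_le_self 2 (by simp only [x]; omega)
    rw [h2] at h3
    have hxq : x q ≤ R * (q - p) := hgap
    have hpos : 0 < 2 ^ Nat.log 2 (x q) := by positivity
    set w := 2 ^ Nat.log 2 (x q)
    by_cases hs : p < t
    · have hx : x p = x q + (q - p) := by simp only [x]; omega
      have : x q * R + w ≤ x p * R := by
        have h : x p * R = x q * R + R * (q - p) := by rw [hx]; ring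
        rw [h]
        exact add_le_add le_rfl (hpow.trans hxq)
      have := Nat.div_le_div_right (c := w) this
      rw [Nat.add_div_right _ hpos] at this
      omega
    · have hx : x q = x p + (q - p) := by simp only [x]; omega
      have : x p * R + w ≤ x q * R := by
        have h : x q * R = x p * R + R * (q - p) := by rw [hx]; ring
        rw [h]
        exact add_le_add le_rfl (hpow.trans hxq)
      have := Nat.div_le_div_right (c := w) this
      rw [Nat.add_div_right _ hpos] at this
      omega
  have hinj : Set.InjOn f ((keptSet R t n).erase t) := by
    intro p hp q hq heq
    rcases lt_trichotomy p q with h | h | h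
    · exact absurd heq (hlt p q hp hq h)
    · exact h
    · exact absurd heq.symm (hlt q p hq hp h)
  have := Finset.card_le_card_of_injOn f hmaps hinj
  have := Finset.pred_card_le_card_erase (s := keptSet R t n) (a := t)
  omega

/-! ### The bits in use -/

namespace AsymStream

theorem Memory.bits_le (m : Memory) (S : Finset ℕ) (M V : ℕ) (hS : m.support ⊆ S)
    (hM : ∀ a ∈ S, a ≤ M) (hV : ∀ a, m a ≤ V) :
    Memory.bits m ≤ S.card * (Nat.size M + Nat.size V) := by
  rw [Memory.bits, Finsupp.sum]
  refine (Finset.sum_le_card_nsmul _ _ (Nat.size M + Nat.size V) fun a ha => ?_).trans ?_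
  · exact add_le_add (Nat.size_le_size (hM a (hS ha))) (Nat.size_le_size (hV a))
  · rw [smul_eq_mul]
    exact Nat.mul_le_mul_right _ (Finset.card_le_card hS)

/-- The cells that are neither zero nor among the first `L` ones belong to the row entries in
`K`, and all contents are at most `V`. -/
def Memory.Fits (L : ℕ) (K : Finset ℕ) (V : ℕ) (m : Memory) : Prop :=
  (∀ a, m a ≠ 0 → a < L ∨ ∃ j ∈ K, a = 11 + 3 * j) ∧ ∀ a, m a ≤ V

/-- Only nonzero cells are charged, so the row counts with the size of `K` and not with its length;
`n` enters only through the length of the addresses. -/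
theorem Memory.Fits.bits_le {L V : ℕ} {K : Finset ℕ} {m : Memory} (h : m.Fits L K V) (n : ℕ)
    (hK : ∀ j ∈ K, j ≤ n) :
    Memory.bits m ≤ (L + K.card) * (Nat.size (L + 11 + 3 * n) + Nat.size V) := by
  let S := Finset.range L ∪ K.image fun j => 11 + 3 * j
  have hcard : S.card ≤ L + K.card :=
    (Finset.card_union_le _ _).trans
      (add_le_add (Finset.card_range L).le Finset.card_image_le)
  refine (Memory.bits_le m S _ V ?_ ?_ h.2).trans (Nat.mul_le_mul_right _ hcard)
  · intro a ha
    rcases h.1 a (Finsupp.mem_support_iff.1 ha) with h | ⟨j, hj, rfl⟩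
    · exact Finset.mem_union_left _ (Finset.mem_range.2 h)
    · exact Finset.mem_union_right _ (Finset.mem_image.2 ⟨j, hj, rfl⟩)
  · intro a ha
    rcases Finset.mem_union.1 ha with h | h
    · have := Finset.mem_range.1 h
      omega
    · obtain ⟨j, hj, rfl⟩ := Finset.mem_image.1 h
      have := hK j hj
      omega

theorem Memory.fits_zero (L V : ℕ) (K : Finset ℕ) : Memory.Fits L K V 0 :=
  ⟨fun _ h => absurd rfl h, fun _ => Nat.zero_le _⟩

theorem Memory.Fits.update {L V : ℕ} {K : Finset ℕ} {m : Memory} (h : m.Fits L K V) {a v : ℕ}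
    (ha : v ≠ 0 → a < L ∨ ∃ j ∈ K, a = 11 + 3 * j) (hv : v ≤ V) :
    Memory.Fits L K V (m.update a v) := by
  refine ⟨fun x hx => ?_, fun x => ?_⟩ <;> by_cases hxa : x = a
  · subst hxa
    simp only [Finsupp.coe_update, Function.update_self] at hx
    exact ha hx
  · simp only [Finsupp.coe_update, Function.update_of_ne hxa] at hx
    exact h.1 x hx
  · subst hxa
    simpa only [Finsupp.coe_update, Function.update_self] using hv
  · simpa only [Finsupp.coe_update, Function.update_of_ne hxa] using h.2 x

/-- Only entries that are nonzero now matter, so `K` can be enlarged at the start of a block and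
shrunk again at its end. -/
theorem Memory.Fits.mono {L V : ℕ} {K K' : Finset ℕ} {m : Memory} (h : m.Fits L K V)
    (hK : ∀ j ∈ K, m (11 + 3 * j) ≠ 0 → j ∈ K') : Memory.Fits L K' V m := by
  refine ⟨fun a ha => ?_, h.2⟩
  rcases h.1 a ha with h | ⟨j, hj, rfl⟩
  · exact Or.inl h
  · exact Or.inr ⟨j, hK j hj ha, rfl⟩

theorem Memory.update_self (m : Memory) (a v : ℕ) :
    (Finsupp.update m a v : Memory) a = v := by
  simp

theorem Memory.update_of_ne (m : Memory) {a x : ℕ} (v : ℕ) (h : x ≠ a) :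
    (Finsupp.update m a v : Memory) x = m x := by
  simp [h]

end AsymStream

/-! ### Total correctness -/

namespace AsymStream

/-- Started with memory `m` and unread stream `s`, the program halts within the space bound, with
a memory and an unread stream that satisfy `Q`. -/
def Ensures (inp : Input) (B : ℕ) (p : Program) (Q : Memory → List ℕ → Prop) (m : Memory)
    (s : List ℕ) : Prop :=
  ∃ c : Config, Runs inp B p ⟨m, s⟩ c ∧ Q c.mem c.stream

section

variable {inp : Input} {B L V : ℕ} {K : Finset ℕ} {Q : Memory → List ℕ → Prop} {m : Memory}
  {s : List ℕ}

theorem Ensures.mono {p : Program} {Q' : Memory → List ℕ → Prop} (h : Ensures inp B p Q m s)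
    (hQ : ∀ m' s', Q m' s' → Q' m' s') : Ensures inp B p Q' m s := by
  obtain ⟨c, hr, hc⟩ := h
  exact ⟨c, hr, hQ _ _ hc⟩

theorem Ensures.seq {p q : Program} (h : Ensures inp B p (Ensures inp B q Q) m s) :
    Ensures inp B (.seq p q) Q m s := by
  obtain ⟨c, hr, c', hr', hc⟩ := h
  exact ⟨c', hr.seq hr', hc⟩

/-- The new memory is known only through its values, so later steps reduce to comparing addresses.
Writing `0` is allowed anywhere, since it uses no bits. -/
theorem Ensures.store {a e : Expr} {A v : ℕ} (hB : ∀ m, Memory.Fits L K V m → m.bits ≤ B)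
    (hm : m.Fits L K V) (ha : a.eval inp m = A) (he : e.eval inp m = v)
    (hA : v ≠ 0 → A < L ∨ ∃ j ∈ K, A = 11 + 3 * j) (hv : v ≤ V)
    (h : ∀ m' : Memory, m'.Fits L K V → m' A = v → (∀ x, x ≠ A → m' x = m x) → Q m' s) :
    Ensures inp B (.store a e) Q m s := by
  subst ha he
  have hm' := hm.update hA hv
  exact ⟨_, .store a e ⟨m, s⟩ (hB _ hm) (hB _ hm'),
    h _ hm' (m.update_self _ _) fun x hx => m.update_of_ne _ hx⟩

theorem Ensures.read {a : Expr} {A : ℕ} (hB : ∀ m, Memory.Fits L K V m → m.bits ≤ B)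
    (hm : m.Fits L K V) (ha : a.eval inp m = A)
    (hA : A < L ∨ ∃ j ∈ K, A = 11 + 3 * j) (hv : s.headD 0 ≤ V)
    (h : ∀ m' : Memory, m'.Fits L K V → m' A = s.headD 0 → (∀ x, x ≠ A → m' x = m x) →
      Q m' s.tail) :
    Ensures inp B (.read a) Q m s := by
  subst ha
  have hm' := hm.update (fun _ => hA) hv
  exact ⟨_, .read a ⟨m, s⟩ (hB _ hm) (hB _ hm'),
    h _ hm' (m.update_self _ _) fun x hx => m.update_of_ne _ hx⟩

theorem Ensures.ite {e : Expr} {p q : Program} (h₁ : e.eval inp m ≠ 0 → Ensures inp B p Q m s)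
    (h₂ : e.eval inp m = 0 → Ensures inp B q Q m s) : Ensures inp B (.ite e p q) Q m s := by
  by_cases h : e.eval inp m = 0
  · obtain ⟨c, hr, hc⟩ := h₂ h
    exact ⟨c, .ite_false h hr, hc⟩
  · obtain ⟨c, hr, hc⟩ := h₁ h
    exact ⟨c, .ite_true h hr, hc⟩

theorem Ensures.loop {e : Expr} {p : Program} (I : Memory → List ℕ → Prop) (f : Memory → ℕ)
    (hI : I m s) (hB : ∀ m s, I m s → m.bits ≤ B)
    (hstep : ∀ m s, I m s → e.eval inp m ≠ 0 →
      Ensures inp B p (fun m' s' => I m' s' ∧ f m' < f m) m s)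
    (hdone : ∀ m s, I m s → e.eval inp m = 0 → Q m s) : Ensures inp B (.loop e p) Q m s := by
  induction hk : f m using Nat.strong_induction_on generalizing m s with
  | _ k ih =>
    by_cases h : e.eval inp m = 0
    · exact ⟨⟨m, s⟩, .loop_done _ (hB _ _ hI) h, hdone _ _ hI h⟩
    · obtain ⟨c, hr, hc, hlt⟩ := hstep m s hI h
      obtain ⟨c', hr', hc'⟩ := ih _ (hk ▸ hlt) hc rfl
      exact ⟨c', .loop_step h hr hr', hc'⟩

end

/-! ### The program -/

/-- The contents of cell `k`. -/
abbrev reg (k : ℕ) : Expr := .load (.const k)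

/-- The `i`-th address of the array that starts at `k`. -/
abbrev entry (k : ℕ) (i : Expr) : Expr := .add (.const k) (.mul (.const 3) i)

/-- The minimum of two expressions. -/
abbrev Expr.minimum (e f : Expr) : Expr := .sub e (.sub e f)

/-- Increase cell `k` by one. -/
abbrev incr (k : ℕ) : Program := .store (.const k) (.add (reg k) (.const 1))

/-- Put the rounded up square root of the length into cell `1`. -/
def findBlockLength : Program :=
  .loop (.lt (.mul (reg 1) (reg 1)) .len) (incr 1)

/-- Read the next block of the stream into the array at `9`; cell `2` counts the characters read
so far, and cell `3` those in the block. -/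
def readBlock : Program :=
  .loop (.mul (.lt (reg 3) (reg 1)) (.lt (reg 2) .len))
    (.seq (.read (entry 9 (reg 3))) (.seq (incr 3) (incr 2)))

/-- The first column of the dynamic program, into the array at `10`. -/
def firstColumn : Program :=
  .loop (.lt (reg 5) (.add (reg 3) (.const 1)))
    (.seq (.store (entry 10 (reg 5)) (.add (.sub (.load (.const 11)) (.const 1)) (reg 5)))
      (incr 5))

/-- From one column of the dynamic program to the next one, except for the top entry. -/
def nextColumn : Program :=
  .loop (.lt (reg 5) (.add (reg 3) (.const 1)))
    (.seq (.store (.const 8) (.load (entry 10 (reg 5))))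
    (.seq (.store (entry 10 (reg 5))
      (.minimum
        (.minimum (.add (reg 8) (.const 1))
          (.add (.load (entry 10 (.sub (reg 5) (.const 1)))) (.const 1)))
        (.add (reg 7) (.sub (.const 1)
          (.eq (.query (.sub (reg 4) (.const 1)))
            (.load (entry 9 (.sub (reg 5) (.const 1)))))))))
    (.seq (.store (.const 7) (reg 8))
      (incr 5))))

/-- The top entry of the next column. -/
def nextTop : Program :=
  .ite (.load (entry 11 (reg 4)))
    (.store (.const 10) (.minimum (.sub (.load (entry 11 (reg 4))) (.const 1))
      (.add (reg 10) (.const 1))))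
    (incr 10)

/-- Replace the row entry in the current column. -/
def updateRow : Program :=
  -- The test of `lastKept` with `R = 4 * q * b`; adding one on the right turns `<` into `≤`.
  .ite (.lt (.add (.sub (reg 4) (reg 2)) (.sub (reg 2) (reg 4)))
      (.add (.mul (.mul (.mul (.const 4) .param) (reg 1)) (.sub (reg 4) (reg 6))) (.const 1)))
    (.seq (.store (entry 11 (reg 4)) (.add (.load (entry 10 (reg 3))) (.const 1)))
      (.store (.const 6) (reg 4)))
    (.store (entry 11 (reg 4)) (.const 0))

/-- All columns but the first one, from left to right. -/
def scanColumns : Program :=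
  .loop (.lt (reg 4) (.add .len (.const 1)))
    -- The old top entry is the diagonal neighbour of the first entry below the top, and is about to
    -- be overwritten.
    (.seq (.store (.const 7) (reg 10))
    (.seq nextTop
    (.seq (.store (.const 5) (.const 1))
    (.seq nextColumn
    (.seq updateRow
      (incr 4))))))

/-- Read a block and bring the row up to date. -/
def processBlock : Program :=
  .seq (.store (.const 3) (.const 0))
  (.seq readBlock
  (.seq (.store (.const 5) (.const 0))
  (.seq firstColumn
  (.seq (.store (.const 11) (.add (.load (entry 10 (reg 3))) (.const 1)))
  (.seq (.store (.const 4) (.const 1))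
  (.seq (.store (.const 6) (.const 0))
  (.seq scanColumns
    (.store (.const 0) (.load (entry 10 (reg 3)))))))))))

/-- Approximate the edit distance. -/
def approxEditDist : Program :=
  .seq findBlockLength
  (.seq (.store (.const 11) (.const 1))
    (.loop (.lt (reg 2) .len) processBlock))

end AsymStream

/-! ### Approximate columns and rows -/

/-- `v` approximates the distance between the prefixes of lengths `p` and `t` from above, within
the factor `F`. -/
def Approx (x y : List ℕ) (F : ℝ) (t p v : ℕ) : Prop :=
  prefixDist x y t p ≤ v ∧ (v : ℝ) ≤ F * prefixDist x y t p

section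

variable {x y : List ℕ} {F : ℝ} {t p : ℕ}

theorem Approx.le (hF : F ≤ 2) {v : ℕ} (h : Approx x y F t p v) (ht : t ≤ y.length)
    (hp : p ≤ x.length) : v ≤ 2 * (t + p) := by
  have h1 : (v : ℝ) ≤ 2 * prefixDist x y t p :=
    h.2.trans (mul_le_mul_of_nonneg_right hF (Nat.cast_nonneg _))
  have h2 : v ≤ 2 * prefixDist x y t p := by exact_mod_cast h1
  have := prefixDist_le x y ht hp
  omega

theorem Approx.succ_zero (hF : 1 ≤ F) {v : ℕ} (h : Approx x y F t 0 v) (ht : t < y.length) :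
    Approx x y F (t + 1) 0 (v + 1) := by
  have h1 := prefixDist_zero_right x y ht
  have h2 := prefixDist_zero_right x y ht.le
  obtain ⟨h3, h4⟩ := h
  rw [h2] at h3 h4
  rw [Approx, h1]
  refine ⟨by omega, ?_⟩
  push_cast
  linarith

/-- The recurrence is a minimum of terms "neighbour plus nonnegative cost". Scaling by `F` commutes
with the minimum and only enlarges the costs, so exact steps preserve the factor. -/
theorem Approx.succ_succ (hF : 1 ≤ F) {u v w : ℕ} (ht : t < y.length) (hp : p < x.length)
    (hu : Approx x y F t (p + 1) u) (hv : Approx x y F (t + 1) p v) (hw : Approx x y F t p w) :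
    Approx x y F (t + 1) (p + 1) (min (min (u + 1) (v + 1))
      (w + if x.getD p 0 = y.getD t 0 then 0 else 1)) := by
  obtain ⟨hu1, hu2⟩ := hu
  obtain ⟨hv1, hv2⟩ := hv
  obtain ⟨hw1, hw2⟩ := hw
  rw [Approx, prefixDist_succ_succ x y ht hp]
  generalize hc : (if x.getD p 0 = y.getD t 0 then 0 else 1 : ℕ) = c
  refine ⟨by omega, ?_⟩
  have hc0 : (0 : ℝ) ≤ c := Nat.cast_nonneg _
  push_cast
  rw [mul_min_of_nonneg _ _ (by linarith), mul_min_of_nonneg _ _ (by linarith)]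
  refine le_min (le_min ?_ ?_) ?_
  · refine (min_le_left _ _).trans ((min_le_right _ _).trans ?_)
    linarith
  · refine (min_le_left _ _).trans ((min_le_left _ _).trans ?_)
    linarith
  · refine (min_le_right _ _).trans ?_
    nlinarith

/-- The nonzero entries of `ρ` exceed the distances by at least one, and every distance is
approximated within the factor `F` by way of some nonzero entry on its left. -/
def RowApprox (x y : List ℕ) (F : ℝ) (t : ℕ) (ρ : ℕ → ℕ) : Prop :=
  (∀ j ≤ x.length, ρ j ≠ 0 → prefixDist x y t j < ρ j) ∧
  ∀ p ≤ x.length, ∃ l ≤ p, ρ l ≠ 0 ∧ ((ρ l - 1 + (p - l) : ℕ) : ℝ) ≤ F * prefixDist x y t p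

/-- Row `0` is `p ↦ p`, so its entry at `0` alone recovers it exactly. -/
theorem rowApprox_zero {ρ : ℕ → ℕ} (h0 : ρ 0 = 1) (hρ : ∀ j, j ≠ 0 → ρ j = 0) :
    RowApprox x y 1 0 ρ := by
  refine ⟨fun j _ hj => ?_, fun p hp => ⟨0, Nat.zero_le _, by omega, ?_⟩⟩
  · have : j = 0 := by
      by_contra h
      exact hj (hρ j h)
    subst this
    rw [prefixDist_zero_left x y (Nat.zero_le _), h0]
    exact Nat.one_pos
  · rw [prefixDist_zero_left x y hp, h0]
    simp

/-- `v` is at least the distance, and at most what each nonzero row entry on the left yields when it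
is extended
to the right by insertions. -/
structure TopApprox (x y : List ℕ) (t : ℕ) (ρ : ℕ → ℕ) (p v : ℕ) : Prop where
  dist_le : prefixDist x y t p ≤ v
  le_row : ∀ l ≤ p, ρ l ≠ 0 → v + 1 ≤ ρ l + (p - l)

theorem TopApprox.approx {ρ : ℕ → ℕ} {v : ℕ} (h : TopApprox x y t ρ p v)
    (hρ : RowApprox x y F t ρ) (hp : p ≤ x.length) : Approx x y F t p v := by
  refine ⟨h.dist_le, ?_⟩
  obtain ⟨l, hl, h0, hle⟩ := hρ.2 p hp
  refine le_trans ?_ hle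
  have := h.le_row l hl h0
  exact_mod_cast (by omega : v ≤ ρ l - 1 + (p - l))

theorem RowApprox.zero_ne {ρ : ℕ → ℕ} (hρ : RowApprox x y F t ρ) : ρ 0 ≠ 0 := by
  obtain ⟨l, hl, h0, -⟩ := hρ.2 0 (Nat.zero_le _)
  rwa [Nat.le_zero.1 hl] at h0

theorem RowApprox.topApprox_zero {ρ : ℕ → ℕ} (hρ : RowApprox x y F t ρ) :
    TopApprox x y t ρ 0 (ρ 0 - 1) := by
  have h0 := hρ.zero_ne
  have := hρ.1 0 (Nat.zero_le _) h0
  refine ⟨by omega, fun l hl _ => ?_⟩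
  rw [Nat.le_zero.1 hl]
  omega

theorem TopApprox.succ_of_zero {ρ : ℕ → ℕ} {v : ℕ} (h : TopApprox x y t ρ p v)
    (hp : p < x.length) (h0 : ρ (p + 1) = 0) : TopApprox x y t ρ (p + 1) (v + 1) := by
  refine ⟨(prefixDist_succ_right_le x y hp).trans (by have := h.dist_le; omega),
    fun l hl hl0 => ?_⟩
  rcases hl.lt_or_eq with hl | rfl
  · have := h.le_row l (by omega) hl0
    omega
  · exact absurd h0 hl0

theorem TopApprox.succ_of_ne_zero {ρ : ℕ → ℕ} {v : ℕ} (h : TopApprox x y t ρ p v)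
    (hρ : RowApprox x y F t ρ) (hp : p < x.length) (h0 : ρ (p + 1) ≠ 0) :
    TopApprox x y t ρ (p + 1) (min (ρ (p + 1) - 1) (v + 1)) := by
  have h1 := hρ.1 (p + 1) hp h0
  have h2 := prefixDist_succ_right_le x y (t := t) hp
  have h3 := h.dist_le
  refine ⟨by omega, fun l hl hl0 => ?_⟩
  rcases hl.lt_or_eq with hl | rfl
  · have := h.le_row l (by omega) hl0
    omega
  · omega

/-- The only place where accuracy is lost. With `l` the last kept position, the distance at `l` may
exceed the one at `p` by `p - l`, and extending from `l` back to `p` adds `p - l` again. Each is at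
most `|p - t| / R`, hence at most the distance at `p` divided by `R`. -/
theorem rowApprox_of_kept {R : ℕ} (hR : 0 < R) {ρ : ℕ → ℕ} (hF : 1 ≤ F) (ht : t ≤ y.length)
    (hρ : ∀ j ≤ x.length, lastKept R t j = j → ρ j ≠ 0 ∧ Approx x y F t j (ρ j - 1))
    (hρ' : ∀ j ≤ x.length, lastKept R t j ≠ j → ρ j = 0) :
    RowApprox x y (F * (1 + 2 / R)) t ρ := by
  refine ⟨fun j hj h0 => ?_, fun p hp => ?_⟩
  · have hk : lastKept R t j = j := by
      by_contra h
      exact h0 (hρ' j hj h)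
    have := (hρ j hj hk).2.1
    omega
  · have hl := lastKept_le R t p
    obtain ⟨h0, -, h1⟩ := hρ _ (hl.trans hp) (lastKept_lastKept R t p)
    refine ⟨lastKept R t p, hl, h0, ?_⟩
    have h2 := (mul_sub_lastKept_le R t p).trans (sub_le_prefixDist x y ht hp)
    have h3 := prefixDist_le_add x y (t := t) hl hp
    set l := lastKept R t p
    have h4 : ((p - l : ℕ) : ℝ) ≤ prefixDist x y t p / R := by
      rw [le_div_iff₀ (by exact_mod_cast hR), mul_comm]
      exact_mod_cast h2
    have h5 : (prefixDist x y t l : ℝ) ≤ prefixDist x y t p + ((p - l : ℕ) : ℝ) := by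
      exact_mod_cast h3
    have h6 : (0 : ℝ) ≤ ((p - l : ℕ) : ℝ) := Nat.cast_nonneg _
    rw [Nat.cast_add]
    calc ((ρ l - 1 : ℕ) : ℝ) + ((p - l : ℕ) : ℝ)
        ≤ F * (prefixDist x y t p + ((p - l : ℕ) : ℝ)) + F * ((p - l : ℕ) : ℝ) := by
          refine add_le_add (h1.trans ?_) ?_
          · exact mul_le_mul_of_nonneg_left h5 (by linarith)
          · nlinarith
      _ = F * (prefixDist x y t p + 2 * ((p - l : ℕ) : ℝ)) := by ring
      _ ≤ F * (prefixDist x y t p + 2 * (prefixDist x y t p / R)) := by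
          refine mul_le_mul_of_nonneg_left ?_ (by linarith)
          linarith
      _ = F * (1 + 2 / R) * prefixDist x y t p := by ring

end

/-! ### The parts of the program -/

namespace AsymStream

section

variable {x y : List ℕ} {q b t n m p B V : ℕ} {K : Finset ℕ} {F : ℝ} {M : Memory} {st : List ℕ}

/-- The memory while a column is computed: the first `i` entries belong to column `p + 1`, the
others to column `p`, and cell `7` holds the entry of column `p` that was overwritten last. -/
structure ColumnInvariant (x y : List ℕ) (F : ℝ) (t p m : ℕ) (M₀ M : Memory) : Prop where
  unchanged : ∀ a, a ≠ 5 → a ≠ 7 → a ≠ 8 → (a < 13 ∨ a % 3 ≠ 1) → M a = M₀ a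
  one_le : 1 ≤ M 5
  le_succ : M 5 ≤ m + 1
  diag : Approx x y F (t + (M 5 - 1)) p (M 7)
  done : ∀ i < M 5, Approx x y F (t + i) (p + 1) (M (10 + 3 * i))
  todo : ∀ i, M 5 ≤ i → i ≤ m → Approx x y F (t + i) p (M (10 + 3 * i))

theorem nextColumn_ensures (hB : ∀ M, Memory.Fits (3 * b + 11) K V M → M.bits ≤ B)
    (hx : x.length = n) (hy : y.length = n) (hV : 4 * n + 10 ≤ V) (hF : 1 ≤ F) (hF2 : F ≤ 2)
    (hmb : m ≤ b) (htm : t + m ≤ n) (hp : p < n) (hM : M.Fits (3 * b + 11) K V)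
    (h3 : M 3 = m) (h4 : M 4 = p + 1) (h5 : M 5 = 1)
    (hblk : ∀ i < m, M (9 + 3 * i) = y.getD (t + i) 0)
    (h7 : Approx x y F t p (M 7)) (h10 : Approx x y F t (p + 1) (M 10))
    (hcol : ∀ i, 1 ≤ i → i ≤ m → Approx x y F (t + i) p (M (10 + 3 * i))) :
    Ensures ⟨x, q⟩ B nextColumn (fun M' s' => s' = st ∧ M'.Fits (3 * b + 11) K V ∧
      (∀ a, a ≠ 5 → a ≠ 7 → a ≠ 8 → (a < 13 ∨ a % 3 ≠ 1) → M' a = M a) ∧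
      ∀ i ≤ m, Approx x y F (t + i) (p + 1) (M' (10 + 3 * i))) M st := by
  refine Ensures.loop
    (fun M' s' => s' = st ∧ M'.Fits (3 * b + 11) K V ∧ ColumnInvariant x y F t p m M M')
    (fun M' => m + 1 - M' 5) ⟨rfl, hM, ?_⟩ (fun M' _ h => hB _ h.2.1) ?_ ?_
  · refine ⟨fun _ _ _ _ _ => rfl, h5.ge, by omega, by simpa [h5] using h7, fun i hi => ?_,
      fun i hi => hcol i (by omega)⟩
    have : i = 0 := by omega
    subst this
    exact h10
  · rintro M' _ ⟨rfl, hfit, hI⟩ hc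
    have e3 : M' 3 = m := by rw [hI.unchanged 3 (by omega) (by omega) (by omega) (by omega), h3]
    have e4 : M' 4 = p + 1 := by
      rw [hI.unchanged 4 (by omega) (by omega) (by omega) (by omega), h4]
    have hi1 := hI.one_le
    obtain ⟨i, hi⟩ : ∃ i, M' 5 = i + 1 := ⟨M' 5 - 1, by omega⟩
    have him : i < m := by
      simp only [Expr.eval, e3, hi] at hc
      by_contra h
      exact hc (if_neg (by omega))
    have eblk : M' (9 + 3 * i) = y.getD (t + i) 0 := by
      rw [hI.unchanged _ (by omega) (by omega) (by omega) (by omega), hblk i him]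
    have hleft : Approx x y F (t + (i + 1)) p (M' (10 + 3 * (i + 1))) :=
      hI.todo (i + 1) (by omega) (by omega)
    have hup : Approx x y F (t + i) (p + 1) (M' (10 + 3 * i)) := hI.done i (by omega)
    have hdiag : Approx x y F (t + i) p (M' 7) := by simpa [hi] using hI.diag
    have hnew := Approx.succ_succ hF (by omega) (by omega) hup hleft hdiag
    -- Since `F ≤ 2`, entries are at most `2 * (t + p) ≤ 4 * n` and fit below `V`.
    have hnewV := hnew.le hF2 (by omega) (by omega)
    have hleftV := hleft.le hF2 (by omega) (by omega)
    refine Ensures.seq (Ensures.store hB hfit (A := 8) rfl (v := M' (10 + 3 * (i + 1)))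
      (by simp [Expr.eval, hi]) (by omega) (by omega) fun M1 f1 u1 k1 => ?_)
    refine Ensures.seq (Ensures.store hB f1 (A := 10 + 3 * (i + 1))
      (v := min (min (M' (10 + 3 * i) + 1) (M' (10 + 3 * (i + 1)) + 1))
        (M' 7 + if x.getD p 0 = y.getD (t + i) 0 then 0 else 1)) ?_ ?_ (by omega) (by omega)
        fun M2 f2 u2 k2 => ?_)
    · simp (disch := omega) [Expr.eval, k1, hi]
    · simp (disch := omega) only [Expr.eval, k1, u1, hi, e4, Nat.add_sub_cancel, eblk]
      split_ifs <;> omega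
    refine Ensures.seq (Ensures.store hB f2 (A := 7) rfl (v := M' (10 + 3 * (i + 1))) ?_ (by omega)
      (by omega) fun M3 f3 u3 k3 => ?_)
    · simp (disch := omega) [Expr.eval, k2, u1]
    refine Ensures.store hB f3 (A := 5) rfl (v := i + 2) ?_ (by omega)
      (by omega) fun M4 f4 u4 k4 => ?_
    · simp (disch := omega) [Expr.eval, k3, k2, k1, hi]
    have e7 : M4 7 = M' (10 + 3 * (i + 1)) := by
      rw [k4 _ (by omega), u3]
    refine ⟨⟨rfl, f4, ?_, by omega, by omega, ?_, ?_, ?_⟩, by omega⟩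
    · intro a h5 h7 h8 ha
      rw [k4 a (by omega), k3 a (by omega), k2 a (by omega), k1 a (by omega)]
      exact hI.unchanged a h5 h7 h8 ha
    · rw [u4, e7]; exact hleft
    · intro j hj
      rw [k4 _ (by omega), k3 _ (by omega)]
      by_cases hji : j = i + 1
      · subst hji; rw [u2]; exact hnew
      · rw [k2 _ (by omega), k1 _ (by omega)]
        exact hI.done j (by omega)
    · intro j hj hjm
      rw [k4 _ (by omega), k3 _ (by omega), k2 _ (by omega), k1 _ (by omega)]
      exact hI.todo j (by omega) hjm
  · rintro M' _ ⟨rfl, hfit, hI⟩ hc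
    have e3 : M' 3 = m := by rw [hI.unchanged 3 (by omega) (by omega) (by omega) (by omega), h3]
    simp only [Expr.eval, e3] at hc
    split_ifs at hc with h
    exact ⟨rfl, hfit, hI.unchanged, fun i hi => hI.done i (by omega)⟩

theorem nextTop_ensures (hB : ∀ M, Memory.Fits (3 * b + 11) K V M → M.bits ≤ B)
    (hx : x.length = n) (hy : y.length = n) (hV : 4 * n + 10 ≤ V) (hF2 : F ≤ 2)
    (ht : t ≤ n) (hp : p < n) {ρ : ℕ → ℕ} (hρ : RowApprox x y F t ρ)
    (hM : M.Fits (3 * b + 11) K V) (h4 : M 4 = p + 1) (hrow : M (11 + 3 * (p + 1)) = ρ (p + 1))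
    (h10 : TopApprox x y t ρ p (M 10)) :
    Ensures ⟨x, q⟩ B nextTop (fun M' s' => s' = st ∧ M'.Fits (3 * b + 11) K V ∧
      (∀ a, a ≠ 10 → M' a = M a) ∧ TopApprox x y t ρ (p + 1) (M' 10)) M st := by
  refine Ensures.ite (fun hc => ?_) (fun hc => ?_)
  · have h0 : ρ (p + 1) ≠ 0 := by simpa [Expr.eval, h4, hrow] using hc
    have hnew := h10.succ_of_ne_zero hρ (by omega) h0
    have := (hnew.approx hρ (by omega)).le hF2 (by omega) (by omega)
    refine Ensures.store hB hM (A := 10) rfl (v := min (ρ (p + 1) - 1) (M 10 + 1)) ?_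
      (by omega) (by omega)
      fun M1 f1 u1 k1 => ⟨rfl, f1, k1, ?_⟩
    · simp only [Expr.eval, h4, hrow]; omega
    · rw [u1]; exact hnew
  · have h0 : ρ (p + 1) = 0 := by simpa [Expr.eval, h4, hrow] using hc
    have hnew := h10.succ_of_zero (by omega) h0
    have := (hnew.approx hρ (by omega)).le hF2 (by omega) (by omega)
    refine Ensures.store hB hM (A := 10) rfl (v := M 10 + 1) rfl
      (by omega) (by omega)
      fun M1 f1 u1 k1 => ⟨rfl, f1, k1, ?_⟩
    rw [u1]; exact hnew

/-- Here `t` is the bottom row of the block. The old entry is replaced in either case, by `0` if the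
position is not kept, which frees its bits. -/
theorem updateRow_ensures (hB : ∀ M, Memory.Fits (3 * b + 11) K V M → M.bits ≤ B)
    (hV : 4 * n + 10 ≤ V) (hp : p < n) (hK : keptSet (4 * q * b) t n ⊆ K)
    (hM : M.Fits (3 * b + 11) K V) (h1 : M 1 = b) (h2 : M 2 = t) (h4 : M 4 = p + 1)
    (h6 : M 6 = lastKept (4 * q * b) t p) (hV' : M (10 + 3 * M 3) + 1 ≤ V) :
    Ensures ⟨x, q⟩ B updateRow (fun M' s' => s' = st ∧ M'.Fits (3 * b + 11) K V ∧
      (∀ a, a ≠ 6 → a ≠ 11 + 3 * (p + 1) → M' a = M a) ∧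
      M' 6 = lastKept (4 * q * b) t (p + 1) ∧
      (lastKept (4 * q * b) t (p + 1) = p + 1 → M' (11 + 3 * (p + 1)) = M (10 + 3 * M 3) + 1) ∧
      (lastKept (4 * q * b) t (p + 1) ≠ p + 1 → M' (11 + 3 * (p + 1)) = 0)) M st := by
  have hle := lastKept_le (4 * q * b) t p
  refine Ensures.ite (fun hc => ?_) (fun hc => ?_)
  · simp only [Expr.eval, h1, h2, h4, h6] at hc
    have hk : lastKept (4 * q * b) t (p + 1) = p + 1 := by
      rw [lastKept, if_pos]
      by_contra h
      exact hc (if_neg (by omega))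
    refine Ensures.seq (Ensures.store hB hM (A := 11 + 3 * (p + 1)) ?_ rfl
      (fun _ => Or.inr ⟨p + 1, hK (mem_keptSet.2 ⟨hp, hk⟩), rfl⟩) hV' fun M1 f1 u1 k1 => ?_)
    · simp [Expr.eval, h4]
    have e4 : M1 4 = p + 1 := by rw [k1 _ (by omega), h4]
    refine Ensures.store hB f1 (A := 6) rfl (v := p + 1) e4 (by omega) (by omega)
      fun M2 f2 u2 k2 => ⟨rfl, f2, fun a ha ha' => ?_, ?_, fun _ => ?_, fun h => absurd hk h⟩
    · rw [k2 a ha, k1 a ha']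
    · rw [u2, hk]
    · rw [k2 _ (by omega), u1]; rfl
  · simp only [Expr.eval, h1, h2, h4, h6] at hc
    have hk : lastKept (4 * q * b) t (p + 1) = lastKept (4 * q * b) t p := by
      rw [lastKept, if_neg]
      intro h
      rw [if_pos (by omega)] at hc
      exact one_ne_zero hc
    refine Ensures.store hB hM (A := 11 + 3 * (p + 1)) ?_ rfl
      (fun h => absurd rfl h) (Nat.zero_le _)
      fun M1 f1 u1 k1 => ⟨rfl, f1, fun a _ ha' => k1 a ha', ?_, fun h => ?_, fun _ => u1⟩
    · simp [Expr.eval, h4]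
    · rw [k1 _ (by omega), h6, hk]
    · omega

/-- The memory while the columns are scanned, after column `p`. -/
structure ScanInvariant (x y : List ℕ) (R : ℕ) (F : ℝ) (t m p : ℕ) (ρ : ℕ → ℕ)
    (M₀ M : Memory) : Prop where
  unchanged : ∀ a, (1 ≤ a ∧ a ≤ 3 ∨ 9 ≤ a ∧ a % 3 = 0) → M a = M₀ a
  four : M 4 = p + 1
  six : M 6 = lastKept R (t + m) p
  top : TopApprox x y t ρ p (M 10)
  column : ∀ i ≤ m, Approx x y F (t + i) p (M (10 + 3 * i))
  old : ∀ j, p < j → M (11 + 3 * j) = ρ j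
  new : ∀ j ≤ p, lastKept R (t + m) j = j →
    M (11 + 3 * j) ≠ 0 ∧ Approx x y F (t + m) j (M (11 + 3 * j) - 1)
  new_zero : ∀ j ≤ p, lastKept R (t + m) j ≠ j → M (11 + 3 * j) = 0

/-- The old row entry at a position is read only when the top of that column is formed, and its
effect further right survives in the running top entry. So it may be overwritten by the new one at
the end of the column. -/
theorem scanColumns_ensures (hB : ∀ M, Memory.Fits (3 * b + 11) K V M → M.bits ≤ B)
    (hx : x.length = n) (hy : y.length = n) (hV : 4 * n + 10 ≤ V) (hF : 1 ≤ F) (hF2 : F ≤ 2)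
    (hmb : m ≤ b) (htm : t + m ≤ n) (hK : keptSet (4 * q * b) (t + m) n ⊆ K)
    {ρ : ℕ → ℕ} (hρ : RowApprox x y F t ρ)
    (hM : M.Fits (3 * b + 11) K V) (h1 : M 1 = b) (h2 : M 2 = t + m) (h3 : M 3 = m)
    (hblk : ∀ i < m, M (9 + 3 * i) = y.getD (t + i) 0)
    (h0 : ScanInvariant x y (4 * q * b) F t m 0 ρ M M) :
    Ensures ⟨x, q⟩ B scanColumns (fun M' s' => s' = st ∧ M'.Fits (3 * b + 11) K V ∧
      ScanInvariant x y (4 * q * b) F t m n ρ M M') M st := by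
  refine Ensures.loop
    (fun M' s' => s' = st ∧ M'.Fits (3 * b + 11) K V ∧
      ∃ p ≤ n, ScanInvariant x y (4 * q * b) F t m p ρ M M')
    (fun M' => n + 1 - M' 4) ⟨rfl, hM, 0, Nat.zero_le _, h0⟩ (fun M' _ h => hB _ h.2.1) ?_ ?_
  · rintro M' _ ⟨rfl, hfit, p, hpn, hI⟩ hc
    have hp : p < n := by
      simp only [Expr.eval, hI.four, hx] at hc
      by_contra h
      exact hc (if_neg (by omega))
    have htop := hI.top.approx hρ (by omega)
    have htopV := htop.le hF2 (by omega) (by omega)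
    refine Ensures.seq (Ensures.store hB hfit (A := 7) rfl (v := M' 10) rfl (by omega) (by omega)
      fun M1 f1 u1 k1 => ?_)
    refine Ensures.seq ((nextTop_ensures hB hx hy hV hF2 (by omega) hp hρ f1
      (by rw [k1 _ (by omega), hI.four]) (by rw [k1 _ (by omega), hI.old _ (by omega)])
      (by rw [k1 _ (by omega)]; exact hI.top)).mono ?_)
    rintro M2 _ ⟨rfl, f2, k2, htop2⟩
    refine Ensures.seq (Ensures.store hB f2 (A := 5) rfl (v := 1) rfl (by omega) (by omega)
      fun M3 f3 u3 k3 => ?_)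
    have htop3 : TopApprox x y t ρ (p + 1) (M3 10) := by rw [k3 _ (by omega)]; exact htop2
    refine Ensures.seq ((nextColumn_ensures hB hx hy hV hF hF2 hmb htm hp f3 ?_ ?_ u3 ?_ ?_
      (htop3.approx hρ (by omega)) ?_).mono ?_)
    · rw [k3 _ (by omega), k2 _ (by omega), k1 _ (by omega), hI.unchanged _ (by omega), h3]
    · rw [k3 _ (by omega), k2 _ (by omega), k1 _ (by omega), hI.four]
    · intro i hi
      rw [k3 _ (by omega), k2 _ (by omega), k1 _ (by omega), hI.unchanged _ (by omega), hblk i hi]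
    · rw [k3 _ (by omega), k2 _ (by omega), u1]; exact htop
    · intro i hi him
      rw [k3 _ (by omega), k2 _ (by omega), k1 _ (by omega)]
      exact hI.column i him
    rintro M4 _ ⟨rfl, f4, k4, hcol⟩
    have e : ∀ a, a ≠ 5 → a ≠ 7 → a ≠ 8 → a ≠ 10 → (a < 13 ∨ a % 3 ≠ 1) → M4 a = M' a := by
      intro a h5 h7 h8 h10 ha
      rw [k4 a h5 h7 h8 ha, k3 a h5, k2 a h10, k1 a h7]
    have e3 : M4 3 = m := by
      rw [e 3 (by omega) (by omega) (by omega) (by omega) (by omega), hI.unchanged _ (by omega), h3]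
    have hlast := (hcol m le_rfl).le hF2 (by omega) (by omega)
    refine Ensures.seq ((updateRow_ensures hB hV hp hK f4 ?_ ?_ ?_ ?_ ?_).mono ?_)
    · rw [e 1 (by omega) (by omega) (by omega) (by omega) (by omega), hI.unchanged _ (by omega), h1]
    · rw [e 2 (by omega) (by omega) (by omega) (by omega) (by omega), hI.unchanged _ (by omega), h2]
    · rw [e 4 (by omega) (by omega) (by omega) (by omega) (by omega), hI.four]
    · rw [e 6 (by omega) (by omega) (by omega) (by omega) (by omega), hI.six]
    · rw [e3]; omega
    rw [e3]
    rintro M5 _ ⟨rfl, f5, k5, u6, hkept, hnot⟩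
    have e4 : M5 4 = p + 1 := by
      rw [k5 4 (by omega) (by omega), e 4 (by omega) (by omega) (by omega) (by omega) (by omega),
        hI.four]
    refine Ensures.store hB f5 (A := 4) rfl (v := p + 2) (by simp [Expr.eval, e4]) (by omega)
      (by omega) fun M6 f6 u7 k6 => ⟨⟨rfl, f6, p + 1, hp, ?_⟩, by rw [u7, hI.four]; omega⟩
    have g : ∀ j, j ≠ p + 1 → M6 (11 + 3 * j) = M' (11 + 3 * j) := by
      intro j hj
      rw [k6 _ (by omega), k5 _ (by omega) (by omega),
        e _ (by omega) (by omega) (by omega) (by omega) (by omega)]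
    refine ⟨fun a ha => ?_, u7, ?_, ?_, fun i hi => ?_, fun j hj => ?_, fun j hj hjk => ?_,
      fun j hj hjk => ?_⟩
    · rw [k6 a (by omega), k5 a (by omega) (by omega),
        e a (by omega) (by omega) (by omega) (by omega) (by omega), hI.unchanged a ha]
    · rw [k6 _ (by omega), u6]
    · rw [k6 _ (by omega), k5 _ (by omega) (by omega),
        k4 _ (by omega) (by omega) (by omega) (by omega)]
      exact htop3
    · rw [k6 _ (by omega), k5 _ (by omega) (by omega)]
      exact hcol i hi
    · rw [g j (by omega), hI.old j (by omega)]
    · by_cases hjp : j = p + 1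
      · subst hjp
        rw [k6 _ (by omega), hkept hjk]
        exact ⟨by omega, hcol m le_rfl⟩
      · rw [g j hjp]
        exact hI.new j (by omega) hjk
    · by_cases hjp : j = p + 1
      · subst hjp
        rw [k6 _ (by omega), hnot hjk]
      · rw [g j hjp]
        exact hI.new_zero j (by omega) hjk
  · rintro M' _ ⟨rfl, hfit, p, hpn, hI⟩ hc
    simp only [Expr.eval, hI.four, hx] at hc
    split_ifs at hc with h
    have : p = n := by omega
    subst this
    exact ⟨rfl, hfit, hI⟩

theorem readBlock_ensures (hB : ∀ M, Memory.Fits (3 * b + 11) K V M → M.bits ≤ B)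
    (hx : x.length = n) (hy : y.length = n) (hV : 4 * n + 10 ≤ V) (hbV : b ≤ n)
    (hyV : ∀ a ∈ y, a ≤ V) (ht : t ≤ n) (hM : M.Fits (3 * b + 11) K V) (h1 : M 1 = b)
    (h2 : M 2 = t) (h3 : M 3 = 0) :
    Ensures ⟨x, q⟩ B readBlock (fun M' s' => s' = y.drop (t + min b (n - t)) ∧
      M'.Fits (3 * b + 11) K V ∧ M' 2 = t + min b (n - t) ∧ M' 3 = min b (n - t) ∧
      (∀ i < min b (n - t), M' (9 + 3 * i) = y.getD (t + i) 0) ∧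
      ∀ a, a ≠ 2 → a ≠ 3 → (a < 9 ∨ a % 3 ≠ 0) → M' a = M a) M (y.drop t) := by
  refine Ensures.loop (fun M' s' => s' = y.drop (t + M' 3) ∧
      M'.Fits (3 * b + 11) K V ∧ M' 2 = t + M' 3 ∧ M' 3 ≤ min b (n - t) ∧
      (∀ i < M' 3, M' (9 + 3 * i) = y.getD (t + i) 0) ∧
      ∀ a, a ≠ 2 → a ≠ 3 → (a < 9 ∨ a % 3 ≠ 0) → M' a = M a)
    (fun M' => b - M' 3) ⟨by rw [h3, add_zero], hM, by omega, by omega, by omega,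
      fun _ _ _ _ => rfl⟩ (fun M' _ h => hB _ h.2.1) ?_ ?_
  · rintro M' _ ⟨rfl, hfit, e2, e3, hblk, e⟩ hc
    have e1 : M' 1 = b := by rw [e 1 (by omega) (by omega) (by omega), h1]
    simp only [Expr.eval, e1, e2, hx, mul_ne_zero_iff] at hc
    have hb : M' 3 < b := by
      by_contra h
      exact hc.1 (if_neg h)
    have hn : t + M' 3 < n := by
      by_contra h
      exact hc.2 (if_neg h)
    have hhead : (y.drop (t + M' 3)).headD 0 = y.getD (t + M' 3) 0 := by
      simp [List.headD_eq_head?_getD, List.head?_drop]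
    have hheadV : y.getD (t + M' 3) 0 ≤ V := by
      rw [List.getD_eq_getElem _ _ (by omega)]
      exact hyV _ (List.getElem_mem _)
    refine Ensures.seq (Ensures.read hB hfit (A := 9 + 3 * M' 3) rfl (by omega)
      (by rw [hhead]; exact hheadV) fun M1 f1 u1 k1 => ?_)
    rw [hhead] at u1
    refine Ensures.seq (Ensures.store hB f1 (A := 3) rfl (v := M' 3 + 1) ?_ (by omega) (by omega)
      fun M2 f2 u2 k2 => ?_)
    · simp (disch := omega) [Expr.eval, k1]
    refine Ensures.store hB f2 (A := 2) rfl (v := t + M' 3 + 1) ?_ (by omega) (by omega)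
      fun M3 f3 u3 k3 => ?_
    · simp (disch := omega) [Expr.eval, k1, k2, e2]
    have e3' : M3 3 = M' 3 + 1 := by rw [k3 _ (by omega), u2]
    refine ⟨⟨?_, f3, by omega, by omega, fun i hi => ?_, fun a h2 h3 ha => ?_⟩, by omega⟩
    · rw [e3', List.tail_drop, add_assoc]
    · rw [k3 _ (by omega), k2 _ (by omega)]
      by_cases hi' : i = M' 3
      · rw [hi', u1]
      · rw [k1 _ (by omega)]
        exact hblk i (by omega)
    · rw [k3 _ h2, k2 _ h3, k1 _ (by omega)]
      exact e a h2 h3 ha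
  · rintro M' _ ⟨rfl, hfit, e2, e3, hblk, e⟩ hc
    have e1 : M' 1 = b := by rw [e 1 (by omega) (by omega) (by omega), h1]
    have e3' : M' 3 = min b (n - t) := by
      simp only [Expr.eval, e1, e2, hx, mul_eq_zero] at hc
      rcases hc with hc | hc <;> split_ifs at hc <;> omega
    rw [← e3']
    exact ⟨rfl, hfit, e2, rfl, hblk, e⟩

theorem firstColumn_ensures (hB : ∀ M, Memory.Fits (3 * b + 11) K V M → M.bits ≤ B)
    (hx : x.length = n) (hy : y.length = n) (hV : 4 * n + 10 ≤ V) (hF : 1 ≤ F) (hF2 : F ≤ 2)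
    (hmb : m ≤ b) (htm : t + m ≤ n) (hM : M.Fits (3 * b + 11) K V) (h3 : M 3 = m)
    (h5 : M 5 = 0) (h11 : Approx x y F t 0 (M 11 - 1)) :
    Ensures ⟨x, q⟩ B firstColumn (fun M' s' => s' = st ∧ M'.Fits (3 * b + 11) K V ∧
      M' 10 = M 11 - 1 ∧ (∀ i ≤ m, Approx x y F (t + i) 0 (M' (10 + 3 * i))) ∧
      ∀ a, a ≠ 5 → (a < 10 ∨ a % 3 ≠ 1) → M' a = M a) M st := by
  have hcol : ∀ i ≤ m, Approx x y F (t + i) 0 (M 11 - 1 + i) := by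
    intro i hi
    induction i with
    | zero => exact h11
    | succ i ih => exact (ih (by omega)).succ_zero hF (by omega)
  refine Ensures.loop (fun M' s' => s' = st ∧ M'.Fits (3 * b + 11) K V ∧ M' 5 ≤ m + 1 ∧
      (∀ i < M' 5, M' (10 + 3 * i) = M 11 - 1 + i) ∧
      ∀ a, a ≠ 5 → (a < 10 ∨ a % 3 ≠ 1) → M' a = M a)
    (fun M' => m + 1 - M' 5) ⟨rfl, hM, by omega, by omega, fun _ _ _ => rfl⟩
    (fun M' _ h => hB _ h.2.1) ?_ ?_
  · rintro M' _ ⟨rfl, hfit, h5', hdone, e⟩ hc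
    have e3 : M' 3 = m := by rw [e 3 (by omega) (by omega), h3]
    simp only [Expr.eval, e3] at hc
    have hm : M' 5 ≤ m := by
      by_contra h
      exact hc (if_neg (by omega))
    have := (hcol _ hm).le hF2 (by omega) (by omega)
    refine Ensures.seq (Ensures.store hB hfit (A := 10 + 3 * M' 5) rfl (v := M 11 - 1 + M' 5) ?_
      (by omega) (by omega) fun M1 f1 u1 k1 => ?_)
    · simp [Expr.eval, e 11 (by omega) (by omega)]
    refine Ensures.store hB f1 (A := 5) rfl (v := M' 5 + 1) ?_ (by omega) (by omega)
      fun M2 f2 u2 k2 => ⟨⟨rfl, f2, by omega, fun i hi => ?_, fun a h5 ha => ?_⟩, by omega⟩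
    · simp (disch := omega) [Expr.eval, k1]
    · rw [k2 _ (by omega)]
      by_cases hi' : i = M' 5
      · rw [hi', u1]
      · rw [k1 _ (by omega)]
        exact hdone i (by omega)
    · rw [k2 _ h5, k1 _ (by omega)]
      exact e a h5 ha
  · rintro M' _ ⟨rfl, hfit, h5', hdone, e⟩ hc
    have e3 : M' 3 = m := by rw [e 3 (by omega) (by omega), h3]
    simp only [Expr.eval, e3] at hc
    split_ifs at hc with h
    refine ⟨rfl, hfit, hdone 0 (by omega), fun i hi => ?_, e⟩
    rw [hdone i (by omega)]
    exact hcol i hi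

end

end AsymStream

/-! ### From one block to the whole stream -/

namespace AsymStream

section

variable {x y : List ℕ} {q b t n B V : ℕ} {F : ℝ} {M : Memory}

/-- The memory between two blocks, after `t` characters of the stream. -/
structure BlockInvariant (x y : List ℕ) (q b V : ℕ) (F : ℝ) (t : ℕ) (M : Memory) : Prop where
  fits : M.Fits (3 * b + 11) (keptSet (4 * q * b) t x.length) V
  one : M 1 = b
  two : M 2 = t
  row : RowApprox x y F t fun j => M (11 + 3 * j)

/-- The bottom entry of the last column still has the factor `F`; only the thinned row for the next
block pays `1 + 2 / R`. In mid-scan the array holds new entries on the left and old ones on the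
right, whence the union of two kept sets in the space bound. -/
theorem processBlock_ensures
    (hB : ∀ t₀ t₁ M, t₀ ≤ n → t₁ ≤ n →
      M.Fits (3 * b + 11) (keptSet (4 * q * b) t₀ n ∪ keptSet (4 * q * b) t₁ n) V →
      Memory.bits M ≤ B)
    (hx : x.length = n) (hy : y.length = n) (hV : 4 * n + 10 ≤ V) (hq : 0 < q) (hb : 0 < b)
    (hbn : b ≤ n) (hyV : ∀ a ∈ y, a ≤ V) (ht : t ≤ n) (hF : 1 ≤ F) (hF2 : F ≤ 2)
    (hM : BlockInvariant x y q b V F t M) :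
    Ensures ⟨x, q⟩ B processBlock (fun M' s' => s' = y.drop (t + min b (n - t)) ∧
      BlockInvariant x y q b V (F * (1 + 2 / (4 * q * b : ℕ))) (t + min b (n - t)) M' ∧
      Approx x y F (t + min b (n - t)) n (M' 0)) M (y.drop t) := by
  obtain ⟨hfit, h1, h2, hρ⟩ := hM
  rw [hx] at hfit
  generalize hm : min b (n - t) = m
  have hmb : m ≤ b := by omega
  have htm : t + m ≤ n := by omega
  set R := 4 * q * b with hR
  replace hB := fun M => hB t (t + m) M ht htm
  replace hfit : M.Fits (3 * b + 11) (keptSet R t n ∪ keptSet R (t + m) n) V :=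
    hfit.mono fun j hj _ => Finset.mem_union_left _ hj
  set K := keptSet R t n ∪ keptSet R (t + m) n with hK
  set ρ : ℕ → ℕ := fun j => M (11 + 3 * j) with hρdef
  have hρj : ∀ j, M (11 + 3 * j) = ρ j := fun _ => rfl
  refine Ensures.seq (Ensures.store hB hfit (A := 3) rfl (v := 0) rfl (by omega) (by omega)
    fun M1 f1 u1 k1 => ?_)
  refine Ensures.seq ((readBlock_ensures hB hx hy hV hbn hyV ht f1 (by rw [k1 _ (by omega), h1])
    (by rw [k1 _ (by omega), h2]) u1).mono ?_)
  rw [hm]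
  rintro M2 _ ⟨rfl, f2, e2, e3, hblk, k2⟩
  refine Ensures.seq (Ensures.store hB f2 (A := 5) rfl (v := 0) rfl (by omega) (by omega)
    fun M3 f3 u3 k3 => ?_)
  have r3 : ∀ j, M3 (11 + 3 * j) = ρ j := by
    intro j
    rw [k3 _ (by omega), k2 _ (by omega) (by omega) (by omega), k1 _ (by omega)]
  have hfirst := hρ.topApprox_zero.approx hρ (Nat.zero_le _)
  have r30 : M3 11 = ρ 0 := r3 0
  refine Ensures.seq ((firstColumn_ensures hB hx hy hV hF hF2 hmb htm f3
    (by rw [k3 _ (by omega), e3]) u3 (by rw [r30]; exact hfirst)).mono ?_)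
  rintro M4 _ ⟨rfl, f4, e10, hcol, k4⟩
  have hlast := (hcol m le_rfl).le hF2 (by omega) (by omega)
  have e3' : M4 3 = m := by rw [k4 _ (by omega) (by omega), k3 _ (by omega), e3]
  refine Ensures.seq (Ensures.store hB f4 (A := 11) rfl (v := M4 (10 + 3 * m) + 1) ?_ (by omega)
    (by omega) fun M5 f5 u5 k5 => ?_)
  · simp [Expr.eval, e3']
  refine Ensures.seq (Ensures.store hB f5 (A := 4) rfl (v := 1) rfl (by omega) (by omega)
    fun M6 f6 u6 k6 => ?_)
  refine Ensures.seq (Ensures.store hB f6 (A := 6) rfl (v := 0) rfl (by omega) (by omega)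
    fun M7 f7 u7 k7 => ?_)
  have c7 : ∀ i, M7 (10 + 3 * i) = M4 (10 + 3 * i) := by
    intro i
    rw [k7 _ (by omega), k6 _ (by omega), k5 _ (by omega)]
  have c70 : M7 10 = M4 10 := c7 0
  have r70 : M7 11 = M4 (10 + 3 * m) + 1 := by rw [k7 _ (by omega), k6 _ (by omega), u5]
  have e7 : M7 1 = b ∧ M7 2 = t + m ∧ M7 3 = m := by
    simp (disch := omega) only [k7, k6, k5, k4, k3, k2, k1, h1, e2, e3, and_self]
  refine Ensures.seq ((scanColumns_ensures (ρ := ρ) (m := m) hB hx hy hV hF hF2 hmb htm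
    Finset.subset_union_right hρ f7 e7.1 e7.2.1 e7.2.2 ?_ ?_).mono ?_)
  · intro i hi
    rw [k7 _ (by omega), k6 _ (by omega), k5 _ (by omega), k4 _ (by omega) (by omega),
      k3 _ (by omega), hblk i hi]
  · refine ⟨fun _ _ => rfl, ?_, u7, ?_, fun i hi => ?_, fun j hj => ?_, fun j hj _ => ?_,
      fun j hj h => ?_⟩
    · rw [k7 _ (by omega), u6]
    · rw [c70, e10, r30]
      exact hρ.topApprox_zero
    · rw [c7]
      exact hcol i hi
    · rw [k7 _ (by omega), k6 _ (by omega), k5 _ (by omega), k4 _ (by omega) (by omega), r3]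
    · obtain rfl : j = 0 := by omega
      simp only [mul_zero, add_zero, r70, Nat.add_sub_cancel]
      exact ⟨by omega, hcol m le_rfl⟩
    · obtain rfl : j = 0 := by omega
      exact absurd rfl h
  rintro M8 _ ⟨rfl, f8, hI⟩
  have hans := hI.column m le_rfl
  have hansV := hans.le hF2 (by omega) (by omega)
  have e8 : M8 3 = m := by rw [hI.unchanged _ (by omega), e7.2.2]
  refine Ensures.store hB f8 (A := 0) rfl (v := M8 (10 + 3 * m)) (by simp [Expr.eval, e8])
    (by omega) (by omega) fun M9 f9 u9 k9 => ⟨rfl, ⟨?_, ?_, ?_, ?_⟩, ?_⟩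
  -- After the last column every surviving old entry has been overwritten, so the kept set of the
  -- new row suffices again.
  · rw [hx]
    refine f9.mono fun j hj h0 => mem_keptSet.2 ?_
    have hjn : j ≤ n := by
      rcases Finset.mem_union.1 hj with h | h <;> exact (mem_keptSet.1 h).1
    refine ⟨hjn, ?_⟩
    by_contra h
    rw [k9 _ (by omega), hI.new_zero j hjn h] at h0
    exact h0 rfl
  · rw [k9 _ (by omega), hI.unchanged _ (by omega), e7.1]
  · rw [k9 _ (by omega), hI.unchanged _ (by omega), e7.2.1]
  · refine rowApprox_of_kept (by positivity) hF (by omega) (fun j hj hk => ?_) fun j hj hk => ?_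
    · rw [k9 _ (by omega)]
      exact hI.new j (by omega) hk
    · rw [k9 _ (by omega)]
      exact hI.new_zero j (by omega) hk
  · rw [u9]
    exact hans

theorem findBlockLength_ensures {K : Finset ℕ} {s : List ℕ}
    (hB : ∀ M, Memory.Fits (3 * b + 11) K V M → M.bits ≤ B)
    (hx : x.length = n) (hbV : b ≤ V) (hb : ∀ c < b, c * c < n) (hb' : n ≤ b * b) :
    Ensures ⟨x, q⟩ B findBlockLength (fun M' s' => s' = s ∧ M'.Fits (3 * b + 11) K V ∧
      M' 1 = b ∧ ∀ a, a ≠ 1 → M' a = 0) 0 s := by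
  refine Ensures.loop (fun M' s' => s' = s ∧ M'.Fits (3 * b + 11) K V ∧
    M' 1 ≤ b ∧ ∀ a, a ≠ 1 → M' a = 0) (fun M' => b - M' 1)
    ⟨rfl, Memory.fits_zero _ _ _, Nat.zero_le _, fun _ _ => rfl⟩ (fun M' _ h => hB _ h.2.1) ?_ ?_
  · rintro M' _ ⟨rfl, hfit, hle, h0⟩ hc
    have hlt : M' 1 < b := by
      refine lt_of_le_of_ne hle fun h => hc ?_
      simp only [Expr.eval, h, hx]
      exact if_neg (by omega)
    refine Ensures.store hB hfit (A := 1) rfl (v := M' 1 + 1) rfl (by omega) (by omega)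
      fun M1 f1 u1 k1 => ⟨⟨rfl, f1, by omega, fun a ha => ?_⟩, by omega⟩
    rw [k1 a ha, h0 a ha]
  · rintro M' _ ⟨rfl, hfit, hle, h0⟩ hc
    refine ⟨rfl, hfit, hle.antisymm ?_, h0⟩
    by_contra h
    simp only [Expr.eval, hx] at hc
    rw [if_pos (hb _ (by omega))] at hc
    exact one_ne_zero hc

theorem approxEditDist_outputs
    (hB : ∀ t₀ t₁ M, t₀ ≤ n → t₁ ≤ n →
      M.Fits (3 * b + 11) (keptSet (4 * q * b) t₀ n ∪ keptSet (4 * q * b) t₁ n) V →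
      Memory.bits M ≤ B)
    (hx : x.length = n) (hy : y.length = n) (hn : 0 < n) (hV : 4 * n + 10 ≤ V) (hq : 0 < q)
    (hb : ∀ c < b, c * c < n) (hb' : n ≤ b * b) (hbn : b ≤ n) (hyV : ∀ a ∈ y, a ≤ V)
    (hF : (1 + 2 / (4 * q * b : ℕ) : ℝ) ^ b ≤ 2) :
    ∃ v, approxEditDist.Outputs q x y B v ∧
      Approx x y ((1 + 2 / (4 * q * b : ℕ) : ℝ) ^ b) n n v := by
  have hb0 : 0 < b := Nat.pos_of_ne_zero fun h => by subst h; omega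
  set G : ℝ := 1 + 2 / (4 * q * b : ℕ) with hG
  have hG1 : 1 ≤ G := by
    have : (0 : ℝ) ≤ 2 / (4 * q * b : ℕ) := by positivity
    linarith
  have hB0 : ∀ t ≤ n, ∀ M : Memory,
      M.Fits (3 * b + 11) (keptSet (4 * q * b) t n) V → M.bits ≤ B := fun t ht M h =>
    hB t t M ht ht (h.mono fun j hj _ => Finset.mem_union_left _ hj)
  suffices h : Ensures ⟨x, q⟩ B approxEditDist (fun M _ => Approx x y (G ^ b) n n (M 0)) 0 y by
    obtain ⟨c, hr, hc⟩ := h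
    exact ⟨_, ⟨c, hr, rfl⟩, hc⟩
  refine Ensures.seq ((findBlockLength_ensures (hB0 0 (Nat.zero_le _)) hx (by omega)
    hb hb').mono ?_)
  rintro M1 _ ⟨hs, f1, e1, z1⟩
  rw [hs]
  refine Ensures.seq (Ensures.store (hB0 0 (Nat.zero_le _)) f1 (A := 11) rfl (v := 1) rfl
    (by omega) (by omega) fun M2 f2 u2 k2 => ?_)
  -- `k` counts the blocks; `t = n` allows for a shorter last one. The claim about cell `0` is void
  -- at the start because `0 < n`.
  refine Ensures.loop (fun M s => ∃ k ≤ b, ∃ t ≤ n, (t = k * b ∨ t = n) ∧ s = y.drop t ∧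
      BlockInvariant x y q b V (G ^ k) t M ∧ (t = n → Approx x y (G ^ b) n n (M 0)))
    (fun M => n - M 2) ?_ ?_ ?_ ?_
  · refine ⟨0, Nat.zero_le _, 0, Nat.zero_le _, Or.inl (by omega), by simp, ⟨?_, ?_, ?_, ?_⟩,
      fun h => by omega⟩
    · rw [hx]; exact f2
    · rw [k2 _ (by omega), e1]
    · rw [k2 _ (by omega), z1 _ (by omega)]
    · rw [pow_zero]
      refine rowApprox_zero u2 fun j hj => ?_
      rw [k2 _ (by omega), z1 _ (by omega)]
  · rintro M s ⟨k, hk, t, ht, -, -, hI, -⟩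
    exact hB0 t ht M (hx ▸ hI.fits)
  · rintro M _ ⟨k, hk, t, ht, htk, rfl, hI, -⟩ hc
    simp only [Expr.eval, hI.two, hx] at hc
    have htn : t < n := by
      by_contra h
      rw [if_neg h] at hc
      exact hc rfl
    have htk : t = k * b := by omega
    -- From `k * b = t < n ≤ b * b`: at most `b` blocks are processed.
    have hkb : k < b := by
      refine Nat.lt_of_mul_lt_mul_right (a := b) ?_
      omega
    have hpow : ∀ i ≤ b, G ^ i ≤ G ^ b := fun i hi => pow_le_pow_right₀ hG1 hi
    refine (processBlock_ensures hB hx hy hV hq hb0 hbn hyV ht (one_le_pow₀ hG1)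
      ((hpow k hk).trans hF) hI).mono ?_
    rintro M' _ ⟨rfl, hI', hans⟩
    refine ⟨⟨k + 1, hkb, t + min b (n - t), by omega, ?_, rfl, ?_, fun h => ?_⟩, ?_⟩
    · rw [add_mul, one_mul, ← htk]
      omega
    · rw [pow_succ]
      exact hI'
    · rw [h] at hans
      exact ⟨hans.1, hans.2.trans (mul_le_mul_of_nonneg_right (hpow k hk) (Nat.cast_nonneg _))⟩
    · rw [hI'.two, hI.two]
      omega
  · rintro M s ⟨k, hk, t, ht, -, -, hI, hans⟩ hc
    simp only [Expr.eval, hI.two, hx] at hc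
    refine hans ?_
    split_ifs at hc with h
    omega

end

end AsymStream

/-! ### Accuracy and space -/

/-- With `u = 2 / (4qb)` and `w = 1 / q` one has `b * u = w / 2`. Bernoulli gives `(1 - u) ^ b ≥ 1 -
w / 2`, and `(1 + u) ^ b * (1 - u) ^ b ≤ 1`, so the power is at most `1 / (1 - w / 2)`, which is at
most `1 + w` because `w ≤ 1`. -/
theorem one_add_pow_le {q b : ℕ} (hq : 0 < q) (hb : 0 < b) :
    (1 + 2 / (4 * q * b : ℕ) : ℝ) ^ b ≤ 1 + 1 / q := by
  have hq' : (1 : ℝ) ≤ q := by exact_mod_cast hq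
  have hb' : (1 : ℝ) ≤ b := by exact_mod_cast hb
  set w : ℝ := 1 / q with hw
  have hw0 : 0 < w := by positivity
  have hw1 : w ≤ 1 := by rw [hw, div_le_one (by linarith)]; exact hq'
  set u : ℝ := 2 / (4 * q * b : ℕ) with hu
  have hbu : b * u = w / 2 := by
    rw [hu, hw]
    push_cast
    field_simp
    norm_num
  have hu0 : 0 ≤ u := by positivity
  have hu1 : u ≤ 1 / 2 := by nlinarith
  have h1 : 1 - w / 2 ≤ (1 - u) ^ b := by
    have := one_add_mul_le_pow (a := -u) (by linarith) b
    rw [← sub_eq_add_neg] at this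
    linarith
  have h2 : (1 + u) ^ b * (1 - u) ^ b ≤ 1 := by
    rw [← mul_pow]
    exact pow_le_one₀ (by nlinarith) (by nlinarith)
  have h3 : (1 + u) ^ b * (1 - w / 2) ≤ (1 + w) * (1 - w / 2) :=
    (mul_le_mul_of_nonneg_left h1 (by positivity)).trans (h2.trans (by nlinarith))
  exact le_of_mul_le_mul_right h3 (by linarith)

theorem half_lt_log_two : (1 / 2 : ℝ) < Real.log 2 := by
  linarith [Real.log_two_gt_d9]

/-- Keeps the logarithms away from zero, so that additive constants can be absorbed into products of
them. -/
theorem half_le_log_add_two (n : ℕ) : (1 / 2 : ℝ) ≤ Real.log (n + 2) := by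
  refine half_lt_log_two.le.trans (Real.log_le_log (by norm_num) ?_)
  have : (0 : ℝ) ≤ n := Nat.cast_nonneg _
  linarith

theorem natLog_add_one_le (n : ℕ) : ((Nat.log 2 n + 1 : ℕ) : ℝ) ≤ 4 * Real.log (n + 2) := by
  have h2 := half_le_log_add_two n
  have h1 : (Nat.log 2 n : ℝ) * Real.log 2 ≤ Real.log (n + 2) := by
    rw [← Real.log_pow]
    refine Real.log_le_log (by positivity) ?_
    have : 2 ^ Nat.log 2 n ≤ n + 2 := by
      rcases Nat.eq_zero_or_pos n with rfl | hn
      · simp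
      · exact (Nat.pow_log_le_self 2 hn.ne').trans (by omega)
    exact_mod_cast this
  have h3 : (Nat.log 2 n : ℝ) * (1 / 2) ≤ Nat.log 2 n * Real.log 2 :=
    mul_le_mul_of_nonneg_left half_lt_log_two.le (Nat.cast_nonneg _)
  push_cast
  linarith

theorem size_le_log {m : ℕ} {c : ℝ} (hc : m ≤ c) (hm : 0 < m) :
    (Nat.size m : ℝ) ≤ 2 * Real.log c + 1 := by
  have hs : 0 < Nat.size m := Nat.size_pos.2 hm
  obtain ⟨k, hk⟩ : ∃ k, Nat.size m = k + 1 := ⟨Nat.size m - 1, by omega⟩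
  have h1 : 2 ^ k ≤ m := Nat.lt_size.1 (by omega)
  have h2 : (k : ℝ) * Real.log 2 ≤ Real.log c := by
    rw [← Real.log_pow]
    refine Real.log_le_log (by positivity) (le_trans ?_ hc)
    exact_mod_cast h1
  have h3 : (k : ℝ) * (1 / 2) ≤ k * Real.log 2 :=
    mul_le_mul_of_nonneg_left half_lt_log_two.le (Nat.cast_nonneg _)
  rw [hk]
  push_cast
  linarith

theorem size_add_size_le {n b σ : ℕ} (hbn : b ≤ n) :
    ((Nat.size (3 * b + 11 + 11 + 3 * n) + Nat.size (σ + 4 * n + 10) : ℕ) : ℝ) ≤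
      52 * (Real.log (n + 2) * Real.log (σ + 2)) := by
  have hL := half_le_log_add_two n
  have hS := half_le_log_add_two σ
  have hn0 : (0 : ℝ) ≤ n := Nat.cast_nonneg _
  have hs0 : (0 : ℝ) ≤ σ := Nat.cast_nonneg _
  have hbn' : (b : ℝ) ≤ n := by exact_mod_cast hbn
  have h2 : Real.log 2 ≤ Real.log (n + 2) := Real.log_le_log (by norm_num) (by linarith)
  have h1 : (Nat.size (3 * b + 11 + 11 + 3 * n) : ℝ) ≤ 2 * Real.log (2 ^ 5 * (n + 2)) + 1 := by
    refine size_le_log ?_ (by omega)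
    push_cast
    linarith
  have h3 : (Nat.size (σ + 4 * n + 10) : ℝ) ≤ 2 * Real.log (2 ^ 3 * ((n + 2) * (σ + 2))) + 1 := by
    refine size_le_log ?_ (by omega)
    push_cast
    nlinarith
  rw [Real.log_mul (by norm_num) (by positivity), Real.log_pow] at h1
  rw [Real.log_mul (by norm_num) (by positivity), Real.log_mul (by positivity) (by positivity),
    Real.log_pow] at h3
  push_cast at h1 h3 ⊢
  -- The sum is at most `20 * log (n + 2) + 2 * log (σ + 2) + 2`; as both logarithms are at least `1
  -- / 2`, the terms contribute `40`, `4` and `8` to the `52`.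
  nlinarith

theorem sqrt_pred_add_one_le {n : ℕ} (hn : 0 < n) :
    ((Nat.sqrt (n - 1) + 1 : ℕ) : ℝ) ≤ 2 * Real.sqrt n := by
  have h1 : (Nat.sqrt (n - 1) : ℝ) ≤ Real.sqrt n := by
    refine Real.le_sqrt_of_sq_le ?_
    have := Nat.sqrt_le' (n - 1)
    exact_mod_cast this.trans (Nat.sub_le _ _)
  have h2 : 1 ≤ Real.sqrt n := Real.one_le_sqrt.2 (by exact_mod_cast hn)
  push_cast
  linarith

theorem ceil_one_div_le {ε : ℝ} (hε : 0 < ε) : (⌈1 / ε⌉₊ : ℝ) ≤ 2 / min ε 1 := by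
  have h := (Nat.ceil_lt_add_one (one_div_pos.2 hε).le).le
  have hmin : 0 < min ε 1 := lt_min hε one_pos
  have h1 : 1 / ε ≤ 1 / min ε 1 := one_div_le_one_div_of_le hmin (min_le_left _ _)
  have h2 : 1 ≤ 1 / min ε 1 := by rw [le_div_iff₀ hmin, one_mul]; exact min_le_right _ _
  have h3 : 2 / min ε 1 = 1 / min ε 1 + 1 / min ε 1 := by ring
  linarith

theorem mainTheorem3 :
    ∃ (P : AsymStream.Program) (C : ℝ) (k : ℕ),
      ∀ (ε : ℝ), 0 < ε →
      ∀ (n : ℕ), 0 < n →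
      ∀ (σ : ℕ) (sbar s : List ℕ), sbar.length = n → s.length = n →
        (∀ a ∈ sbar, a < σ) → (∀ a ∈ s, a < σ) →
        ∃ v B : ℕ,
          P.Outputs ⌈1 / ε⌉₊ sbar s B v ∧
          editDist sbar s ≤ v ∧
          (v : ℝ) ≤ (1 + ε) * (editDist sbar s : ℝ) ∧
          (B : ℝ) ≤ C * (Real.sqrt n / min ε 1) * Real.log (n + 2) ^ k * Real.log (σ + 2) := by
  -- `40000` rounds up `768 * 52`. One logarithm of `n` counts the dyadic scales, the other is the
  -- size of a cell.
  refine ⟨AsymStream.approxEditDist, 40000, 2, fun ε hε n hn σ x y hx hy _ hyσ => ?_⟩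
  set q := ⌈1 / ε⌉₊ with hqdef
  have hq : 0 < q := Nat.ceil_pos.2 (one_div_pos.2 hε)
  -- For `n ≥ 1` this is `⌈√n⌉`.
  set b := Nat.sqrt (n - 1) + 1 with hbdef
  have hb : 0 < b := Nat.succ_pos _
  have hlt : ∀ c < b, c * c < n := fun c hc => by
    have := Nat.le_sqrt.1 (Nat.lt_succ_iff.1 hc)
    omega
  have hnb : n ≤ b * b := by
    have : n - 1 < b * b := Nat.lt_succ_sqrt (n - 1)
    omega
  have hbn : b ≤ n := by
    have := Nat.sqrt_le_self (n - 1)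
    omega
  have hpow := one_add_pow_le hq hb
  have hqε : 1 / (q : ℝ) ≤ ε := by
    rw [div_le_comm₀ (by exact_mod_cast hq) hε]
    exact Nat.le_ceil _
  have hq1 : (1 : ℝ) ≤ q := by exact_mod_cast hq
  have hB : ∀ (t₀ t₁ : ℕ) (M : AsymStream.Memory), t₀ ≤ n → t₁ ≤ n →
      M.Fits (3 * b + 11) (keptSet (4 * q * b) t₀ n ∪ keptSet (4 * q * b) t₁ n) (σ + 4 * n + 10) →
      M.bits ≤ (3 * b + 11 + 2 * (4 * (4 * q * b) * (Nat.log 2 n + 1) + 1)) *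
        (Nat.size (3 * b + 11 + 11 + 3 * n) + Nat.size (σ + 4 * n + 10)) := by
    intro t₀ t₁ M h0 h1 hM
    refine (hM.bits_le n fun j hj => ?_).trans (Nat.mul_le_mul_right _ ?_)
    · rcases Finset.mem_union.1 hj with h | h <;> exact (mem_keptSet.1 h).1
    · have hR : 0 < 4 * q * b := by positivity
      have h2 := card_keptSet_le hR h0
      have h3 := card_keptSet_le hR h1
      have h4 := Finset.card_union_le (keptSet (4 * q * b) t₀ n) (keptSet (4 * q * b) t₁ n)
      omega
  obtain ⟨v, hv, hle, hv'⟩ := AsymStream.approxEditDist_outputs hB hx hy hn (by omega) hq hlt hnb hbn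
    (fun a ha => by have := hyσ a ha; omega)
    (hpow.trans (by rw [← one_add_one_eq_two]; gcongr; exact (div_le_one (by linarith)).2 hq1))
  have hd : prefixDist x y n n = editDist x y := by
    simpa only [hx, hy] using prefixDist_length x y
  rw [hd] at hle hv'
  refine ⟨v, _, hv, hle, hv'.trans ?_, ?_⟩
  · exact mul_le_mul_of_nonneg_right (hpow.trans (by linarith)) (Nat.cast_nonneg _)
  · have hL := half_le_log_add_two n
    have hS := half_le_log_add_two σ
    have hmin : 0 < min ε 1 := lt_min hε one_pos
    have hqb : (q : ℝ) * b ≤ 4 * (Real.sqrt n / min ε 1) := by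
      calc (q : ℝ) * b ≤ 2 / min ε 1 * (2 * Real.sqrt n) :=
            mul_le_mul (ceil_one_div_le hε) (sqrt_pred_add_one_le hn) (by positivity)
              (by positivity)
        _ = 4 * (Real.sqrt n / min ε 1) := by ring
    have hcount : ((3 * b + 11 + 2 * (4 * (4 * q * b) * (Nat.log 2 n + 1) + 1) : ℕ) : ℝ) ≤
        768 * (Real.sqrt n / min ε 1) * Real.log (n + 2) := by
      -- Each of `b` and `1` is at most `q * b * (Nat.log 2 n + 1)`, and `3 + 13 + 32 = 48`.
      have h1 : 3 * b + 11 + 2 * (4 * (4 * q * b) * (Nat.log 2 n + 1) + 1) ≤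
          48 * (q * b) * (Nat.log 2 n + 1) := by
        have h2 : b ≤ q * b := Nat.le_mul_of_pos_left b hq
        have h3 : q * b ≤ q * b * (Nat.log 2 n + 1) := Nat.le_mul_of_pos_right _ (by omega)
        have h4 : 4 * (4 * q * b) * (Nat.log 2 n + 1) =
          16 * (q * b * (Nat.log 2 n + 1)) := by ring
        have h5 : 48 * (q * b) * (Nat.log 2 n + 1) = 48 * (q * b * (Nat.log 2 n + 1)) := by ring
        omega
      refine (Nat.cast_le.2 h1).trans ?_
      rw [Nat.cast_mul]
      calc ((48 * (q * b) : ℕ) : ℝ) * ((Nat.log 2 n + 1 : ℕ) : ℝ)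
          ≤ 48 * (4 * (Real.sqrt n / min ε 1)) * (4 * Real.log (n + 2)) := by
            refine mul_le_mul ?_ (natLog_add_one_le n) (by positivity) (by positivity)
            push_cast
            linarith
        _ = 768 * (Real.sqrt n / min ε 1) * Real.log (n + 2) := by ring
    rw [Nat.cast_mul]
    calc _ ≤ 768 * (Real.sqrt n / min ε 1) * Real.log (n + 2) *
          (52 * (Real.log (n + 2) * Real.log (σ + 2))) :=
          mul_le_mul hcount (size_add_size_le hbn) (by positivity) (by positivity)
      _ = 39936 * (Real.sqrt n / min ε 1 * Real.log (n + 2) ^ 2 * Real.log (σ + 2)) := by ring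
      _ ≤ 40000 * (Real.sqrt n / min ε 1 * Real.log (n + 2) ^ 2 * Real.log (σ + 2)) :=
          mul_le_mul_of_nonneg_right (by norm_num) (by positivity)
      _ = _ := by ring
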